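/- Let $h(x)=2\arcsin\sqrt{x}$ and, for $f:[0,1]\to[0,1]$, let $P_f=P_f^n$ be the law of the path $(Y_t)_{t\in[0,1]}$ in the Gaussian white noise model $dY_t = 2\arcsin(\sqrt{f(t)})\,dt + n^{-1/2}\,dW_t$, $Y_0=0$, where $W$ is a standard Brownian motion; write $\operatorname{KL}(f,g)=\operatorname{KL}(P_f,P_g)$ for the Kullback–Leibler divergence. For $\beta>0$ let $\lfloor\beta\rfloor$ be the greatest integer strictly smaller than $\beta$, and put $$\|f\|_{\mathcal H_B^\beta}=\|f\|_{C^\beta}+|f|_{\mathcal H^\beta}+|1-f|_{\mathcal H^\beta},$$ $$\|f\|_{C^\beta}=\|f\|_\infty+\|f^{(\lfloor\beta\rfloor)}\|_\infty+\sup_{x\ne y}\frac{|f^{(\lfloor\beta\rfloor)}(x)-f^{(\lfloor\beta\rfloor)}(y)|}{|x-y|^{\beta-\lfloor\beta\rfloor}},\qquad |f|_{\mathcal H^\beta}=\max_{1\le j<\beta}\Big(\sup_{x\in[0,1]}\frac{|f^{(j)}(x)|^\beta}{|f(x)|^{\beta-j}}\Big)^{1/j},$$ all on $[0,1]$, with $0/0=0$,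 $|f|_{\mathcal H^\beta}=0$ for $\beta\le1$, and $\|f\|_{C^\beta}=\infty$ if $f^{(\lfloor\beta\rfloor)}$ does not exist. Let $$r_{n,\beta}^B(y)=n^{-\frac{\beta}{\beta+1}}\vee\big(y(1-y)/n\big)^{\frac{\beta}{2\beta+1}}.$$ Theorem. For any $\beta>0$ and $0\le R_0<R$ there is a constant $C=C(\beta,R_0,R)>0$ such that for every $x_0\in[0,1]$ and every sequence $(f_n^*)_n$ of functions $[0,1]\to[0,1]$ with $\limsup_{n\to\infty}\|f_n^*\|_{\mathcal H_B^\beta}\le R_0$, $$\liminf_{n\to\infty}\ \inf_{\hat f_n(x_0)}\ \sup_{\substack{f:[0,1]\to[0,1],\ \|f\|_{\mathcal H_B^\beta}\le R\\ \operatorname{KL}(f,f_n^*)\le 1}} P_f\left(\frac{|\hat f_n(x_0)-f(x_0)|}{r_{n,\beta}^B(f(x_0))}\ge C\right)>0,$$ where the infimum is over all measurable estimators of $f(x_0)$, i.e. all real-valued measurable functionals of the path $(Y_t)_{t\in[0,1]}$. -/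

import Mathlib

open MeasureTheory ProbabilityTheory Filter Set
open scoped ENNReal NNReal

/-! ### Function spaces on `[0, 1]`

A function on `[0, 1]` is represented by a function `f : ℝ → ℝ`. Everything below depends only on
the restriction of `f` to `[0, 1]`; derivatives on `[0, 1]` are one-sided at the end points.
Norms take values in `[0, ∞]`. -/

/-- The greatest integer strictly smaller than `β`, for `β > 0`. -/
noncomputable def strictFloor (β : ℝ) : ℕ := ⌈β⌉₊ - 1

/-- The `j`-th derivative of `f` on `[0, 1]`. -/
noncomputable def unitDeriv (j : ℕ) (f : ℝ → ℝ) (x : ℝ) : ℝ :=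
  iteratedDerivWithin j f (Icc 0 1) x

/-- The supremum norm on `[0, 1]`. -/
noncomputable def unitSupNorm (f : ℝ → ℝ) : ℝ≥0∞ :=
  ⨆ x ∈ Icc (0 : ℝ) 1, ENNReal.ofReal |f x|

/-- The Hölder seminorm `|f|_{C^β}`: the `(β - ⌊β⌋)`-Hölder constant of `f^(⌊β⌋)` on `[0, 1]`. -/
noncomputable def holderSeminorm (β : ℝ) (f : ℝ → ℝ) : ℝ≥0∞ :=
  ⨆ x ∈ Icc (0 : ℝ) 1, ⨆ y ∈ Icc (0 : ℝ) 1, ⨆ _ : x ≠ y,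
    ENNReal.ofReal (|unitDeriv (strictFloor β) f x - unitDeriv (strictFloor β) f y| /
      |x - y| ^ (β - (strictFloor β : ℝ)))

open scoped Classical in
/-- The Hölder norm `‖f‖_{C^β} = ‖f‖_∞ + ‖f^(⌊β⌋)‖_∞ + |f|_{C^β}`, infinite if `f^(⌊β⌋)` does not
exist. (Asking for continuity of `f^(⌊β⌋)` changes nothing: the norm is infinite without it.) -/
noncomputable def holderNorm (β : ℝ) (f : ℝ → ℝ) : ℝ≥0∞ :=
  if ContDiffOn ℝ (strictFloor β : ℕ) f (Icc 0 1) then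
    unitSupNorm f + unitSupNorm (unitDeriv (strictFloor β) f) + holderSeminorm β f
  else ∞

/-- The flatness seminorm
`|f|_{H^β} = max_{1 ≤ j < β} (sup_{x ∈ [0, 1]} |f^(j)(x)|^β / |f(x)|^(β - j))^(1/j)`, which is `0`
for `β ≤ 1`. Division in `[0, ∞]` satisfies `0 / 0 = 0` and `a / 0 = ∞` for `a > 0`. -/
noncomputable def flatSeminorm (β : ℝ) (f : ℝ → ℝ) : ℝ≥0∞ :=
  ⨆ (j : ℕ) (_ : 1 ≤ j) (_ : (j : ℝ) < β),
    (⨆ x ∈ Icc (0 : ℝ) 1,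
      ENNReal.ofReal (|unitDeriv j f x| ^ β) / ENNReal.ofReal (|f x| ^ (β - (j : ℝ)))) ^
        (1 / (j : ℝ))

/-- `‖f‖_{H_B^β} = ‖f‖_{C^β} + |f|_{H^β} + |1 - f|_{H^β}`. -/
noncomputable def bernoulliNorm (β : ℝ) (f : ℝ → ℝ) : ℝ≥0∞ :=
  holderNorm β f + flatSeminorm β f + flatSeminorm β (fun x => 1 - f x)

/-- The closed ball `{f : [0, 1] → [0, 1] : ‖f‖_{H_B^β} ≤ R}`. -/
def bernoulliBall (β R : ℝ) : Set (ℝ → ℝ) :=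
  {f | MapsTo f (Icc 0 1) (Icc 0 1) ∧ bernoulliNorm β f ≤ ENNReal.ofReal R}

/-! ### The white noise model -/

/-- The link function `h(x) = 2 arcsin √x`. -/
noncomputable def arcsinLink (x : ℝ) : ℝ := 2 * Real.arcsin (Real.sqrt x)

/-- The observed path `Y_t = ∫_0^t h(f(s)) ds + n^(-1/2) W_t`, `t ∈ [0, 1]`, that is, the solution
of `dY_t = h(f(t)) dt + n^(-1/2) dW_t` with `Y_0 = 0`. -/
noncomputable def observedPath {Ω : Type*} (W : ℝ≥0 → Ω → ℝ) (n : ℕ) (f : ℝ → ℝ) (ω : Ω)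
    (t : unitInterval) : ℝ :=
  (∫ s in (0 : ℝ)..t, arcsinLink (f s)) + (Real.sqrt n)⁻¹ * W (unitInterval.toNNReal t) ω

/-- The law `P_f` of the observed path, on the space of real functions on `[0, 1]` with the
σ-algebra generated by the evaluations. -/
noncomputable def pathLaw {Ω : Type*} [MeasurableSpace Ω] (P : Measure Ω) (W : ℝ≥0 → Ω → ℝ)
    (n : ℕ) (f : ℝ → ℝ) : Measure (unitInterval → ℝ) :=
  P.map (observedPath W n f)

/-- The local parameter space `{f : ‖f‖_{H_B^β} ≤ R, KL(P_f, P_{f*}) ≤ 1}`. -/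
def localSpace {Ω : Type*} [MeasurableSpace Ω] (P : Measure Ω) (W : ℝ≥0 → Ω → ℝ)
    (β R : ℝ) (n : ℕ) (fstar : ℝ → ℝ) : Set (ℝ → ℝ) :=
  {f | f ∈ bernoulliBall β R ∧
    InformationTheory.klDiv (pathLaw P W n f) (pathLaw P W n fstar) ≤ 1}

/-- The rate `r_{n,β}^B(y) = n^(-β/(β+1)) ∨ (y (1 - y) / n)^(β/(2β+1))`. -/
noncomputable def bernoulliRate (n : ℕ) (β y : ℝ) : ℝ :=
  max ((n : ℝ) ^ (-(β / (β + 1)))) ((y * (1 - y) / n) ^ (β / (2 * β + 1)))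

/-- The measurable real-valued estimators, that is, measurable functionals of the observed path. -/
abbrev Estimator : Type := {g : (unitInterval → ℝ) → ℝ // Measurable g}

/-!
The lower bound is a two-point argument: for large `n`, near every `g = fstar n` there is an `f` in
the ball of radius `R` with `KL(P_f, P_g) ≤ 1` whose value at `x₀` differs from `g x₀` by a multiple
of the rates at both values (`exists_alternative`). An estimate cannot be within
`C` times the respective rate of both values, so every estimator fails with probability at least
`1 / 8` under one of the two laws.

*The alternative.* Let `φ` be whichever of `g`, `1 - g` is at most `1 / 2` at `x₀`, and `y = φ x₀`.
Then `φ` is raised by a bump of height `η b ^ β` and bandwidth `b` proportional to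
`n ^ (-1 / (β + 1)) ∨ (y / n) ^ (1 / (2 β + 1))`. The bump is a high power of a smooth bump
function, so its `j`-th derivative is dominated by its power `1 - j / β`
(`exists_flat_bump`); since the flatness seminorm is a bound of the same form for `φ`, the norms
grow by little when `η` is small (`flatSeminorm_add_le_of_flat`, `flatSeminorm_sub_le_of_flat`,
`eventually_flatness_budget`). The squared drift `(h(φ + ψ) - h(φ))²` is at most
`4 π² min(ψ, ψ² / φ)`: the first bound serves small `y`, and for large `y` the second one does,
because a flat function stays above half its value on the scale `y ^ (1 / β)`
(`exists_half_le_of_flat`).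

*The statistical distance.* With `c = h(f) - h(g)`, let `X = ∫ c dW`, built in the closed span of the
`W_t` in `L²(P)` (`exists_wienerIntegral`). The process `W` splits into a part independent of `X`
and a multiple of `X`, and `cov(X, W_t) = ∫_0^t c`, so that passing from `g` to `f` only translates
the one-dimensional Gaussian variable `X`. The `χ²`-divergence is therefore at most
`exp(n ‖c‖²) - 1`, which bounds the Kullback–Leibler divergence and, by the Cauchy–Schwarz
inequality, yields `P_f(A)² ≤ exp(n ‖c‖²) P_g(A)` for every event `A`
(`pathLaw_divergence_bounds`).
-/

/-! ### Gaussian Hilbert spaces -/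

open scoped RealInnerProductSpace in
/-- If two families of vectors have the same Gram matrix, every vector `c` on the first side has a
counterpart `z` in the closed span of the second family, of norm at most `‖c‖` and with the same
inner products. -/
lemma exists_mem_closure_span_inner_eq {ι H₁ H₂ : Type*}
    [NormedAddCommGroup H₁] [InnerProductSpace ℝ H₁] [CompleteSpace H₁]
    [NormedAddCommGroup H₂] [InnerProductSpace ℝ H₂] [CompleteSpace H₂]
    (e : ι → H₁) (w : ι → H₂) (hew : ∀ i j, ⟪e i, e j⟫ = ⟪w i, w j⟫) (c : H₁) :
    ∃ z ∈ (Submodule.span ℝ (range w)).topologicalClosure,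
      ‖z‖ ≤ ‖c‖ ∧ ∀ i, ⟪z, w i⟫ = ⟪c, e i⟫ := by
  classical
  set L₁ := Finsupp.linearCombination ℝ e
  set L₂ := Finsupp.linearCombination ℝ w
  have hinner : ∀ l m : ι →₀ ℝ, ⟪L₁ l, L₁ m⟫ = ⟪L₂ l, L₂ m⟫ := by
    intro l m
    simp only [L₁, L₂, Finsupp.linearCombination_apply, Finsupp.sum_inner, Finsupp.inner_sum,
      real_inner_smul_left, real_inner_smul_right, hew]
  have hnorm : ∀ l, ‖L₁ l‖ = ‖L₂ l‖ := by
    intro l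
    rw [@norm_eq_sqrt_real_inner _ _ _ (L₁ l), @norm_eq_sqrt_real_inner _ _ _ (L₂ l), hinner]
  set K := (Submodule.span ℝ (range e)).topologicalClosure
  have : CompleteSpace K := (Submodule.isClosed_topologicalClosure _).completeSpace_coe
  set p : K := K.orthogonalProjectionOnto c
  have hpmem : (p : H₁) ∈ closure ((Submodule.span ℝ (range e) : Submodule ℝ H₁) : Set H₁) := by
    rw [← Submodule.topologicalClosure_coe]; exact p.2
  obtain ⟨x, hx, hxp⟩ := mem_closure_iff_seq_limit.1 hpmem
  have hl : ∀ k, ∃ l, L₁ l = x k := fun k => by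
    have := hx k
    rw [SetLike.mem_coe, ← Finsupp.range_linearCombination] at this
    exact this
  choose l hl using hl
  have hcauchy : CauchySeq fun k => L₂ (l k) := by
    have := hxp.cauchySeq
    rw [Metric.cauchySeq_iff] at this ⊢
    intro ε hε
    obtain ⟨N, hN⟩ := this ε hε
    refine ⟨N, fun m hm n hn => ?_⟩
    have := hN m hm n hn
    rwa [← hl, ← hl, dist_eq_norm, ← map_sub, hnorm, map_sub, ← dist_eq_norm] at this
  obtain ⟨z, hz⟩ := cauchySeq_tendsto_of_complete hcauchy
  refine ⟨z, ?_, ?_, fun i => ?_⟩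
  · rw [← SetLike.mem_coe, Submodule.topologicalClosure_coe]
    refine mem_closure_of_tendsto hz (Eventually.of_forall fun k => ?_)
    rw [SetLike.mem_coe, ← Finsupp.range_linearCombination]
    exact ⟨l k, rfl⟩
  · have h1 : ‖z‖ = ‖(p : H₁)‖ := by
      refine tendsto_nhds_unique hz.norm ?_
      have := hxp.norm
      refine this.congr fun k => ?_
      rw [← hl, hnorm]
    rw [h1]
    exact K.norm_orthogonalProjectionOnto_apply_le c
  · have h1 : Tendsto (fun k => ⟪L₂ (l k), w i⟫) atTop (nhds ⟪z, w i⟫) :=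
      hz.inner tendsto_const_nhds
    have h2 : Tendsto (fun k => ⟪x k, e i⟫) atTop (nhds ⟪(p : H₁), e i⟫) :=
      hxp.inner tendsto_const_nhds
    have h3 : ∀ k, ⟪x k, e i⟫ = ⟪L₂ (l k), w i⟫ := fun k => by
      have := hinner (l k) (Finsupp.single i 1)
      simpa [L₁, L₂, hl] using this
    simp_rw [h3] at h2
    rw [tendsto_nhds_unique h1 h2]
    have h4 : ⟪c - p, e i⟫ = 0 := by
      have he : e i ∈ K :=
        Submodule.le_topologicalClosure _ (Submodule.subset_span (mem_range_self i))
      exact K.starProjection_inner_eq_zero c (e i) he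
    rw [inner_sub_left] at h4
    linarith

/-- Square-integrable variables with a centred normal law form a closed subset of `L²`. -/
lemma isClosed_setOf_map_eq_gaussianReal {Ω : Type*} [MeasurableSpace Ω] (P : Measure Ω)
    [IsProbabilityMeasure P] :
    IsClosed {Z : Lp ℝ 2 P | P.map Z = gaussianReal 0 (‖Z‖₊ ^ 2)} := by
  have hset : {Z : Lp ℝ 2 P | P.map Z = gaussianReal 0 (‖Z‖₊ ^ 2)} =
      ⋂ u : ℝ, {Z : Lp ℝ 2 P | ∫ ω, Complex.exp ((u * Z ω : ℝ) * Complex.I) ∂P =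
        Complex.exp (-((‖Z‖ ^ 2 * u ^ 2 / 2 : ℝ) : ℂ))} := by
    ext Z
    have hm : AEMeasurable (Z : Ω → ℝ) P := (Lp.aestronglyMeasurable Z).aemeasurable
    have : IsProbabilityMeasure (P.map Z) := Measure.isProbabilityMeasure_map hm
    have hcf : ∀ u : ℝ, charFun (P.map Z) u =
        ∫ ω, Complex.exp ((u * Z ω : ℝ) * Complex.I) ∂P := by
      intro u
      rw [charFun_apply_real, integral_map hm (by fun_prop)]
      simp
    have hg : ∀ u : ℝ, charFun (gaussianReal 0 (‖Z‖₊ ^ 2)) u =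
        Complex.exp (-((‖Z‖ ^ 2 * u ^ 2 / 2 : ℝ) : ℂ)) := by
      intro u
      rw [charFun_gaussianReal]
      simp
    simp only [mem_ofPred_eq, mem_iInter, ← hcf, ← hg]
    exact ⟨fun h u => by rw [h], fun h => Measure.ext_of_charFun (funext h)⟩
  rw [hset]
  refine isClosed_iInter fun u => isClosed_eq ?_ (by fun_prop)
  have hexp : ∀ a b : ℝ, ‖Complex.exp (a * Complex.I) - Complex.exp (b * Complex.I)‖ ≤ |a - b| := by
    intro a b
    have h : Complex.exp (a * Complex.I) - Complex.exp (b * Complex.I) =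
        Complex.exp (b * Complex.I) * (Complex.exp (Complex.I * (a - b : ℝ)) - 1) := by
      rw [mul_sub, ← Complex.exp_add]
      push_cast; ring_nf
    rw [h, norm_mul, Complex.norm_exp_ofReal_mul_I, one_mul]
    simpa using Real.norm_exp_I_mul_ofReal_sub_one_le (x := a - b)
  have hint : ∀ Z : Lp ℝ 2 P, Integrable (fun ω => Complex.exp ((u * Z ω : ℝ) * Complex.I)) P := by
    intro Z
    refine Integrable.of_bound (C := 1) ?_ (Eventually.of_forall fun ω => ?_)
    · have := (Lp.aestronglyMeasurable Z).aemeasurable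
      exact AEMeasurable.aestronglyMeasurable (by fun_prop)
    · rw [Complex.norm_exp_ofReal_mul_I]
  refine (LipschitzWith.of_dist_le_mul (K := ‖u‖₊) fun Z Z' => ?_).continuous
  rw [dist_eq_norm, ← integral_sub (hint Z) (hint Z')]
  have hdiff : Integrable (fun ω => ‖(Z - Z' : Lp ℝ 2 P) ω‖) P :=
    ((Lp.memLp (Z - Z')).integrable (by norm_num)).norm
  calc ‖∫ ω, (Complex.exp ((u * Z ω : ℝ) * Complex.I) -
        Complex.exp ((u * Z' ω : ℝ) * Complex.I)) ∂P‖
      ≤ ∫ ω, ‖u‖ * ‖(Z - Z' : Lp ℝ 2 P) ω‖ ∂P := by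
        refine norm_integral_le_of_norm_le (hdiff.const_mul _) ?_
        filter_upwards [Lp.coeFn_sub Z Z'] with ω hω
        refine (hexp _ _).trans (le_of_eq ?_)
        rw [hω, Pi.sub_apply, ← mul_sub, abs_mul, Real.norm_eq_abs, Real.norm_eq_abs]
    _ = ‖u‖ * ∫ ω, ‖(Z - Z' : Lp ℝ 2 P) ω‖ ∂P := integral_const_mul _ _
    _ ≤ ‖u‖ * dist Z Z' := by
        refine mul_le_mul_of_nonneg_left ?_ (norm_nonneg _)
        rw [dist_eq_norm, Lp.norm_def, integral_norm_eq_lintegral_enorm (Lp.aestronglyMeasurable _),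
          ← eLpNorm_one_eq_lintegral_enorm]
        exact ENNReal.toReal_mono (Lp.eLpNorm_ne_top _)
          (eLpNorm_le_eLpNorm_of_exponent_le (by norm_num) (Lp.aestronglyMeasurable _))

/-- The closed linear span in `L²` of a centred Gaussian process consists of centred normal
variables. -/
lemma map_eq_gaussianReal_of_mem_closure_span {Ω T : Type*} [MeasurableSpace Ω] {P : Measure Ω}
    [IsProbabilityMeasure P] {W : T → Ω → ℝ} (hW : IsGaussianProcess W P)
    (hW0 : ∀ t, ∫ ω, W t ω ∂P = 0) (hL : ∀ t, MemLp (W t) 2 P) {Z : Lp ℝ 2 P}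
    (hZ : Z ∈ (Submodule.span ℝ (range fun t => (hL t).toLp)).topologicalClosure) :
    P.map Z = gaussianReal 0 (‖Z‖₊ ^ 2) := by
  classical
  rw [← SetLike.mem_coe, Submodule.topologicalClosure_coe] at hZ
  refine (isClosed_setOf_map_eq_gaussianReal P).closure_subset_iff.2 ?_ hZ
  intro Z hZ
  rw [SetLike.mem_coe, ← Finsupp.range_linearCombination] at hZ
  obtain ⟨l, rfl⟩ := hZ
  set Z := Finsupp.linearCombination ℝ (fun t => (hL t).toLp) l with hZdef
  have hae : (Z : Ω → ℝ) =ᵐ[P] fun ω => ∑ i : l.support, l i * W i ω := by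
    have h1 : Z = ∑ i ∈ l.support, l i • (hL i).toLp := by
      rw [hZdef, Finsupp.linearCombination_apply, Finsupp.sum]
    rw [h1]
    refine (Lp.coeFn_finsetSum _ _).trans ?_
    have h2 : ∀ᵐ ω ∂P, ∀ i : l.support, (l i • (hL i).toLp : Lp ℝ 2 P) ω = l i * W i ω := by
      rw [ae_all_iff]
      intro i
      filter_upwards [Lp.coeFn_smul (l i) (hL i).toLp, (hL i).coeFn_toLp] with ω h h'
      rw [h, Pi.smul_apply, h', smul_eq_mul]
    filter_upwards [h2] with ω h
    rw [Finset.sum_apply, ← Finset.sum_attach]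
    exact Finset.sum_congr rfl fun i _ => h i
  have hG : HasGaussianLaw (Z : Ω → ℝ) P := by
    let L : (l.support → ℝ) →L[ℝ] ℝ := ∑ i : l.support, l i • ContinuousLinearMap.proj i
    refine HasGaussianLaw.congr ((hW.hasGaussianLaw l.support).map L) ?_
    refine EventuallyEq.trans ?_ hae.symm
    exact Eventually.of_forall fun ω => by simp [L]
  have hmean : ∫ ω, Z ω ∂P = 0 := by
    rw [integral_congr_ae hae, integral_finsetSum]
    · simp [integral_const_mul, hW0]
    · exact fun i _ => ((hL i).integrable (by norm_num)).const_mul _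
  rw [mem_ofPred_eq, hG.map_eq_gaussianReal, hmean]
  congr 1
  rw [variance_of_integral_eq_zero (Lp.aestronglyMeasurable Z).aemeasurable hmean]
  have : ∫ ω, Z ω ^ 2 ∂P = ‖Z‖ ^ 2 := by
    rw [← real_inner_self_eq_norm_sq, L2.inner_def]
    exact integral_congr_ae (Eventually.of_forall fun ω => by simp [sq])
  rw [this]
  ext
  simp [Real.coe_toNNReal _ (sq_nonneg ‖Z‖)]

/-- Elements of the closed linear span of a centred Gaussian process are jointly Gaussian. -/
lemma isGaussianProcess_of_mem_closure_span {Ω T S : Type*} [MeasurableSpace Ω] {P : Measure Ω}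
    [IsProbabilityMeasure P] {W : T → Ω → ℝ} (hW : IsGaussianProcess W P)
    (hW0 : ∀ t, ∫ ω, W t ω ∂P = 0) (hL : ∀ t, MemLp (W t) 2 P) (Z : S → Lp ℝ 2 P)
    (hZ : ∀ s, Z s ∈ (Submodule.span ℝ (range fun t => (hL t).toLp)).topologicalClosure) :
    IsGaussianProcess (fun s => (Z s : Ω → ℝ)) P where
  hasGaussianLaw I := by
    classical
    refine ⟨isGaussian_of_map_eq_gaussianReal fun L => ?_⟩
    have hm : AEMeasurable (fun ω => I.restrict fun s => Z s ω) P :=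
      aemeasurable_pi_lambda _ fun i => (Lp.aestronglyMeasurable (Z i)).aemeasurable
    set Y : Lp ℝ 2 P := ∑ i : I, L (Pi.single i 1) • Z i
    have hY := map_eq_gaussianReal_of_mem_closure_span hW hW0 hL (Z := Y)
      (Submodule.sum_mem _ fun i _ => Submodule.smul_mem _ _ (hZ i))
    refine ⟨_, _, Eq.trans ?_ hY⟩
    rw [AEMeasurable.map_map_of_aemeasurable (by fun_prop) hm]
    refine Measure.map_congr ?_
    have h2 : ∀ᵐ ω ∂P, ∀ i : I, (L (Pi.single i 1) • Z i : Lp ℝ 2 P) ω =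
        L (Pi.single i 1) * Z i ω := by
      rw [ae_all_iff]
      intro i
      filter_upwards [Lp.coeFn_smul (L (Pi.single i 1)) (Z i)] with ω h
      rw [h, Pi.smul_apply, smul_eq_mul]
    filter_upwards [h2, Lp.coeFn_finsetSum Finset.univ fun i : I => L (Pi.single i 1) • Z i]
      with ω h h'
    rw [Function.comp_apply, h', Finset.sum_apply]
    simp_rw [h]
    conv_lhs => rw [← Finset.univ_sum_single (I.restrict fun s => Z s ω), map_sum]
    refine Finset.sum_congr rfl fun i _ => ?_
    have : (Pi.single i (I.restrict (fun s => Z s ω) i) : I → ℝ) =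
        (Z i ω) • Pi.single i 1 := by
      rw [← Pi.single_smul]; simp
    rw [this, map_smul, smul_eq_mul, mul_comm]

/-- Existence of the Wiener integral `X = ∫ c dW` of `c ∈ L²(0, 1)`, through the properties that
matter here. Only `Var X ≤ ‖c‖²` is claimed. -/
lemma exists_wienerIntegral {Ω : Type*} [MeasurableSpace Ω] {P : Measure Ω} {W : ℝ≥0 → Ω → ℝ}
    (hW : IsPreBrownianReal W P) (c : ℝ → ℝ) (hc : MemLp c 2 (volume.restrict (Ioc 0 1))) :
    ∃ X : Ω → ℝ, Measurable X ∧
      IsGaussianProcess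
        (Sum.elim (fun t : unitInterval => W (unitInterval.toNNReal t)) fun _ : Unit => X) P ∧
      ∫ ω, X ω ∂P = 0 ∧ Var[X; P] ≤ ∫ x in Ioc 0 1, c x ^ 2 ∧
      ∀ t : unitInterval, cov[X, W (unitInterval.toNNReal t); P] = ∫ s in (0 : ℝ)..t, c s := by
  have hprob : IsProbabilityMeasure P := hW.isGaussianProcess.isProbabilityMeasure
  set V : unitInterval → Ω → ℝ := fun t => W (unitInterval.toNNReal t)
  have hV : IsGaussianProcess V P := hW.isGaussianProcess.comp_right unitInterval.toNNReal
  have hV0 : ∀ t, ∫ ω, V t ω ∂P = 0 := fun t => hW.integral_eval _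
  have hL : ∀ t, MemLp (V t) 2 P := fun t => (hV.hasGaussianLaw_eval t).memLp_two
  have hcovV : ∀ s t, ∫ ω, V s ω * V t ω ∂P = min (s : ℝ) t := by
    intro s t
    have := hW.covariance_eval (unitInterval.toNNReal s) (unitInterval.toNNReal t)
    rw [covariance_eq_sub (hL s) (hL t), hV0 s, zero_mul, sub_zero] at this
    simpa using this
  set e : unitInterval → Lp ℝ 2 (volume.restrict (Ioc (0 : ℝ) 1)) := fun t =>
    indicatorConstLp 2 (measurableSet_Ioc (a := 0) (b := (t : ℝ))) (by finiteness) 1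
  have hinner : ∀ Z Z' : Lp ℝ 2 P, inner ℝ Z Z' = ∫ ω, Z ω * Z' ω ∂P := by
    intro Z Z'
    rw [L2.inner_def]
    exact integral_congr_ae (Eventually.of_forall fun ω => by simp [mul_comm])
  have hew : ∀ i j, inner ℝ (e i) (e j) = inner ℝ (hL i).toLp (hL j).toLp := by
    intro i j
    rw [L2.real_inner_indicatorConstLp_one_indicatorConstLp_one, hinner]
    have : ∫ ω, (hL i).toLp (V i) ω * (hL j).toLp (V j) ω ∂P = ∫ ω, V i ω * V j ω ∂P := by
      refine integral_congr_ae ?_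
      filter_upwards [(hL i).coeFn_toLp, (hL j).coeFn_toLp] with ω h h'
      rw [h, h']
    rw [this, hcovV, measureReal_restrict_apply (by measurability), Ioc_inter_Ioc, Ioc_inter_Ioc]
    have h1 : min (min (i : ℝ) j) 1 = min (i : ℝ) j := min_eq_left (min_le_left _ _ |>.trans i.2.2)
    have h0 : 0 ≤ min (i : ℝ) j := le_min i.2.1 j.2.1
    simp [h1, h0]
  obtain ⟨Z, hZ, hZn, hZc⟩ := exists_mem_closure_span_inner_eq e _ hew hc.toLp
  set X : Ω → ℝ := (Lp.aestronglyMeasurable Z).mk with hX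
  have hXm : Measurable X := (Lp.aestronglyMeasurable Z).stronglyMeasurable_mk.measurable
  have hXZ : (Z : Ω → ℝ) =ᵐ[P] X := (Lp.aestronglyMeasurable Z).ae_eq_mk
  have hX2 : MemLp X 2 P := (Lp.memLp Z).ae_eq hXZ
  have hmap := map_eq_gaussianReal_of_mem_closure_span hV hV0 hL hZ
  have hXlaw : HasLaw X (gaussianReal 0 (‖Z‖₊ ^ 2)) P :=
    ⟨hXm.aemeasurable, by rw [← hmap]; exact Measure.map_congr hXZ.symm⟩
  have hX0 : ∫ ω, X ω ∂P = 0 := by rw [hXlaw.integral_eq, integral_id_gaussianReal]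
  refine ⟨X, hXm, ?_, hX0, ?_, fun t => ?_⟩
  · refine (isGaussianProcess_of_mem_closure_span hV hV0 hL
      (Sum.elim (fun t => (hL t).toLp) fun _ : Unit => Z) ?_).congr ?_
    · rintro (t | _)
      · exact Submodule.le_topologicalClosure _ (Submodule.subset_span (mem_range_self t))
      · exact hZ
    · rintro (t | _)
      · exact (hL t).coeFn_toLp
      · exact hXZ
  · rw [hXlaw.variance_eq, variance_id_gaussianReal]
    have : ∫ x in Ioc 0 1, c x ^ 2 = ‖hc.toLp‖ ^ 2 := by
      rw [← real_inner_self_eq_norm_sq, L2.inner_def]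
      refine integral_congr_ae ?_
      filter_upwards [hc.coeFn_toLp] with x hx
      simp [hx, sq]
    rw [this]
    push_cast
    gcongr
  · rw [covariance_eq_sub hX2 (hL t), hX0, zero_mul, sub_zero]
    have h1 : ∫ ω, (X * V t) ω ∂P = inner ℝ Z (hL t).toLp := by
      rw [hinner]
      refine integral_congr_ae ?_
      filter_upwards [(hL t).coeFn_toLp, hXZ] with ω h h'
      rw [h, h', Pi.mul_apply]
    rw [h1, hZc t, real_inner_comm, L2.inner_indicatorConstLp_one,
      intervalIntegral.integral_of_le t.2.1, Measure.restrict_restrict measurableSet_Ioc,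
      inter_eq_left.2 (Ioc_subset_Ioc_right t.2.2)]
    refine integral_congr_ae (ae_restrict_of_ae_restrict_of_subset
      (Ioc_subset_Ioc_right t.2.2) hc.coeFn_toLp)

/-! ### Divergence bounds from a square-integrable density -/

section ChiSquare

variable {α : Type*} [MeasurableSpace α] {μ : Measure α} {ρ : α → ℝ} {K : ℝ≥0∞}

/-- The Kullback–Leibler divergence is at most the `χ²`-divergence. -/
lemma klDiv_withDensity_add_one_le [IsProbabilityMeasure μ] (hρ : Measurable ρ) (hρ0 : ∀ x, 0 ≤ ρ x)
    (hρ1 : ∫⁻ x, ENNReal.ofReal (ρ x) ∂μ = 1) (hK : ∫⁻ x, ENNReal.ofReal (ρ x ^ 2) ∂μ ≤ K) :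
    InformationTheory.klDiv (μ.withDensity fun x => ENNReal.ofReal (ρ x)) μ + 1 ≤ K := by
  have hm : Measurable fun x => ENNReal.ofReal (ρ x) := hρ.ennreal_ofReal
  have hfin : IsFiniteMeasure (μ.withDensity fun x => ENNReal.ofReal (ρ x)) :=
    isFiniteMeasure_withDensity (by simp [hρ1])
  rw [InformationTheory.klDiv_eq_lintegral_klFun_of_ac (withDensity_absolutelyContinuous _ _)]
  have h1 : ∫⁻ x, ENNReal.ofReal (InformationTheory.klFun
      ((μ.withDensity fun x => ENNReal.ofReal (ρ x)).rnDeriv μ x).toReal) ∂μ =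
      ∫⁻ x, ENNReal.ofReal (InformationTheory.klFun (ρ x)) ∂μ := by
    refine lintegral_congr_ae ?_
    filter_upwards [Measure.rnDeriv_withDensity μ hm] with x hx
    rw [hx, ENNReal.toReal_ofReal (hρ0 x)]
  -- `klFun x ≤ (x - 1) ^ 2`, since `log x ≤ x - 1`
  have hkl : ∀ x, InformationTheory.klFun (ρ x) + 2 * ρ x ≤ ρ x ^ 2 + 1 := by
    intro x
    rw [InformationTheory.klFun_apply]
    rcases (hρ0 x).eq_or_lt with h | h
    · simp [← h]
    · nlinarith [Real.log_le_sub_one_of_pos h]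
  have h2 : ∫⁻ x, ENNReal.ofReal (InformationTheory.klFun (ρ x)) ∂μ + 2 ≤ K + 1 := by
    calc ∫⁻ x, ENNReal.ofReal (InformationTheory.klFun (ρ x)) ∂μ + 2
        = ∫⁻ x, (ENNReal.ofReal (InformationTheory.klFun (ρ x)) + 2 * ENNReal.ofReal (ρ x)) ∂μ := by
          rw [lintegral_add_right _ (hm.const_mul 2), lintegral_const_mul _ hm, hρ1, mul_one]
      _ ≤ ∫⁻ x, (ENNReal.ofReal (ρ x ^ 2) + 1) ∂μ := by
          refine lintegral_mono fun x => ?_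
          have h3 : (2 : ℝ≥0∞) * ENNReal.ofReal (ρ x) = ENNReal.ofReal (2 * ρ x) := by
            rw [ENNReal.ofReal_mul (by norm_num)]; simp
          have h4 := InformationTheory.klFun_nonneg (hρ0 x)
          rw [h3, ← ENNReal.ofReal_add h4 (by linarith [hρ0 x]), ← ENNReal.ofReal_one,
            ← ENNReal.ofReal_add (sq_nonneg _) zero_le_one]
          exact ENNReal.ofReal_le_ofReal (hkl x)
      _ = ∫⁻ x, ENNReal.ofReal (ρ x ^ 2) ∂μ + 1 := by
          rw [lintegral_add_right _ measurable_const]; simp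
      _ ≤ K + 1 := by gcongr
  rw [h1]
  rw [← one_add_one_eq_two, ← add_assoc] at h2
  exact (ENNReal.add_le_add_iff_right ENNReal.one_ne_top).1 h2

/-- Change of measure by the Cauchy–Schwarz inequality. -/
lemma withDensity_sq_le (hρ : Measurable ρ) (hK : ∫⁻ x, ENNReal.ofReal (ρ x ^ 2) ∂μ ≤ K)
    (hρ0 : ∀ x, 0 ≤ ρ x) {A : Set α} (hA : MeasurableSet A) :
    (μ.withDensity fun x => ENNReal.ofReal (ρ x)) A ^ 2 ≤ K * μ A := by
  rw [withDensity_apply _ hA]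
  have h := ENNReal.lintegral_mul_le_Lp_mul_Lq (μ.restrict A) Real.HolderConjugate.two_two
    (f := fun x => ENNReal.ofReal (ρ x)) (g := 1) (by fun_prop) (by fun_prop)
  simp only [Pi.mul_apply, Pi.one_apply, mul_one, ENNReal.one_rpow, lintegral_const,
    Measure.restrict_apply_univ, one_mul] at h
  have h1 : ∫⁻ x in A, ENNReal.ofReal (ρ x) ^ (2 : ℝ) ∂μ ≤ K := by
    refine le_trans (setLIntegral_le_lintegral _ _) (le_trans (le_of_eq ?_) hK)
    refine lintegral_congr fun x => ?_
    rw [ENNReal.ofReal_rpow_of_nonneg (hρ0 x) (by norm_num), Real.rpow_two]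
  calc (∫⁻ x in A, ENNReal.ofReal (ρ x) ∂μ) ^ 2
      ≤ ((∫⁻ x in A, ENNReal.ofReal (ρ x) ^ (2 : ℝ) ∂μ) ^ (1 / 2 : ℝ) * μ A ^ (1 / 2 : ℝ)) ^ 2 := by
        gcongr
    _ = (∫⁻ x in A, ENNReal.ofReal (ρ x) ^ (2 : ℝ) ∂μ) * μ A := by
        rw [mul_pow, ← ENNReal.rpow_two, ← ENNReal.rpow_two, ← ENNReal.rpow_mul,
          ← ENNReal.rpow_mul]
        norm_num
    _ ≤ K * μ A := by gcongr

end ChiSquare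

/-- The density of `N(1, v)` with respect to `N(0, v)`. -/
noncomputable def gaussianShiftDensity (v : ℝ≥0) (x : ℝ) : ℝ := Real.exp ((2 * x - 1) / (2 * v))

lemma measurable_gaussianShiftDensity (v : ℝ≥0) : Measurable (gaussianShiftDensity v) := by
  unfold gaussianShiftDensity; fun_prop

lemma gaussianReal_one_eq_withDensity {v : ℝ≥0} (hv : v ≠ 0) :
    gaussianReal 1 v =
      (gaussianReal 0 v).withDensity fun x => ENNReal.ofReal (gaussianShiftDensity v x) := by
  have hv' : (0 : ℝ) < v := by positivity
  rw [gaussianReal_of_var_ne_zero _ hv, gaussianReal_of_var_ne_zero _ hv,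
    ← withDensity_mul _ (by fun_prop) (measurable_gaussianShiftDensity v).ennreal_ofReal]
  congr 1
  ext x
  rw [Pi.mul_apply, gaussianPDF, gaussianPDF, ← ENNReal.ofReal_mul (gaussianPDFReal_nonneg _ _ _)]
  congr 1
  simp only [gaussianPDFReal, gaussianShiftDensity]
  rw [mul_assoc _ (Real.exp _), ← Real.exp_add]
  congr 2
  field_simp
  ring

lemma lintegral_gaussianShiftDensity_sq {v : ℝ≥0} (hv : v ≠ 0) :
    ∫⁻ x, ENNReal.ofReal (gaussianShiftDensity v x ^ 2) ∂gaussianReal 0 v =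
      ENNReal.ofReal (Real.exp (1 / v)) := by
  have hv' : (0 : ℝ) < v := by positivity
  have h : ∀ x, gaussianShiftDensity v x ^ 2 = Real.exp (-(1 / v)) * Real.exp (2 / v * x) := by
    intro x
    rw [gaussianShiftDensity, ← Real.exp_nat_mul, ← Real.exp_add]
    congr 1
    push_cast
    field_simp
    ring
  simp_rw [h]
  rw [← ofReal_integral_eq_lintegral_ofReal]
  · congr 1
    rw [integral_const_mul]
    have := congrFun (mgf_fun_id_gaussianReal (μ := 0) (v := v)) (2 / v)
    rw [mgf] at this
    rw [this, ← Real.exp_add]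
    congr 1
    field_simp
    ring
  · exact (integrable_exp_mul_gaussianReal _).const_mul _
  · exact Eventually.of_forall fun x => by positivity

/-! ### Translates of Brownian motion -/

/-- A Brownian motion agrees, almost surely at all times, with a process whose coordinates are
measurable. -/
lemma exists_measurable_indistinguishable {Ω : Type*} [MeasurableSpace Ω] {P : Measure Ω}
    {W : ℝ≥0 → Ω → ℝ} (hW : IsBrownianReal W P) :
    ∃ W' : ℝ≥0 → Ω → ℝ, (∀ t, Measurable (W' t)) ∧ ∀ᵐ ω ∂P, ∀ t, W t ω = W' t ω := by
  classical
  set d : ℕ → ℝ≥0 := TopologicalSpace.denseSeq ℝ≥0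
  have hd : DenseRange d := TopologicalSpace.denseRange_denseSeq _
  have hm : ∀ t, AEMeasurable (W t) P := hW.aemeasurable
  have hae : ∀ᵐ ω ∂P, Continuous (W · ω) ∧ ∀ k, W (d k) ω = (hm (d k)).mk _ ω :=
    hW.cont.and (ae_all_iff.2 fun k => (hm (d k)).ae_eq_mk)
  obtain ⟨N, hN, hNm, hN0⟩ := exists_measurable_superset_of_null (ae_iff.1 hae)
  refine ⟨fun t ω => if ω ∈ N then 0 else W t ω, fun t => ?_, ?_⟩
  · have ht : t ∈ closure (range d) := hd t
    obtain ⟨x, hx, hxt⟩ := mem_closure_iff_seq_limit.1 ht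
    choose k hk using hx
    refine measurable_of_tendsto_metrizable
      (f := fun i ω => if ω ∈ N then 0 else (hm (d (k i))).mk _ ω) (fun i => ?_) ?_
    · exact Measurable.ite hNm measurable_const (hm _).measurable_mk
    · rw [tendsto_pi_nhds]
      intro ω
      by_cases hω : ω ∈ N
      · simp [hω]
      · have := not_not.1 fun h => hω (hN h)
        simp only [hω, if_false]
        refine (((this.1.tendsto t).comp hxt).congr fun i => ?_)
        rw [Function.comp_apply, ← hk i, this.2]
  · have : ∀ᵐ ω ∂P, ω ∉ N := measure_eq_zero_iff_ae_notMem.1 hN0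
    filter_upwards [this] with ω hω t
    simp [hω]

lemma measurable_observedPath {Ω : Type*} [MeasurableSpace Ω] {W : ℝ≥0 → Ω → ℝ}
    (hW : ∀ t, Measurable (W t)) (n : ℕ) (f : ℝ → ℝ) : Measurable (observedPath W n f) := by
  refine measurable_pi_lambda _ fun t => ?_
  unfold observedPath
  exact measurable_const.add ((hW _).const_mul _)

/-- One-dimensional reduction of a shift: if `ξ ∼ N(0, v)` is independent of the process `V`, the
laws of `V + ξ m` and `V + (ξ + 1) m` are the images of `law V ⊗ N(0, v)` and `law V ⊗ N(1, v)`
under one and the same map. -/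
lemma divergence_of_independent_gaussian_direction {Ω T : Type*} [MeasurableSpace Ω] {P : Measure Ω}
    [IsProbabilityMeasure P] {V : T → Ω → ℝ} {ξ : Ω → ℝ} {v : ℝ≥0} (hv : v ≠ 0) (m : T → ℝ)
    (hV : ∀ t, Measurable (V t)) (hξ : Measurable ξ) (hξlaw : P.map ξ = gaussianReal 0 v)
    (hind : IndepFun (fun ω t => V t ω) ξ P) :
    InformationTheory.klDiv (P.map fun ω t => V t ω + (ξ ω + 1) * m t)
        (P.map fun ω t => V t ω + ξ ω * m t) + 1 ≤ ENNReal.ofReal (Real.exp (1 / v)) ∧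
      ∀ A : Set (T → ℝ), MeasurableSet A → (P.map fun ω t => V t ω + (ξ ω + 1) * m t) A ^ 2 ≤
        ENNReal.ofReal (Real.exp (1 / v)) * (P.map fun ω t => V t ω + ξ ω * m t) A := by
  have hVm : Measurable fun ω t => V t ω := measurable_pi_lambda _ hV
  set μ := P.map fun ω t => V t ω
  have hμ : IsProbabilityMeasure μ := Measure.isProbabilityMeasure_map hVm.aemeasurable
  set Φ : (T → ℝ) × ℝ → T → ℝ := fun p t => p.1 t + p.2 * m t
  have hΦ : Measurable Φ := measurable_pi_lambda _ fun t => by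
    exact ((measurable_pi_apply t).comp measurable_fst).add (measurable_snd.mul_const _)
  have h0 : P.map (fun ω t => V t ω + ξ ω * m t) = (μ.prod (gaussianReal 0 v)).map Φ := by
    rw [← hξlaw, ← (indepFun_iff_map_prod_eq_prod_map_map hVm.aemeasurable hξ.aemeasurable).1 hind,
      Measure.map_map hΦ (hVm.prodMk hξ)]
    rfl
  have h1 : P.map (fun ω t => V t ω + (ξ ω + 1) * m t) =
      (μ.prod (gaussianReal 1 v)).map Φ := by
    have hξ1 : P.map (fun ω => ξ ω + 1) = gaussianReal 1 v := by
      have := (gaussianReal_add_const (X := ξ) ⟨hξ.aemeasurable, hξlaw⟩ 1).map_eq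
      simpa using this
    have hind1 : IndepFun (fun ω t => V t ω) (fun ω => ξ ω + 1) P :=
      hind.comp measurable_id (measurable_id.add_const 1)
    have hm1 : Measurable fun ω => ξ ω + 1 := hξ.add_const 1
    rw [← hξ1, ← (indepFun_iff_map_prod_eq_prod_map_map hVm.aemeasurable hm1.aemeasurable).1 hind1,
      Measure.map_map hΦ (hVm.prodMk hm1)]
    rfl
  set ρ : (T → ℝ) × ℝ → ℝ := fun p => gaussianShiftDensity v p.2
  have hρ : Measurable ρ := (measurable_gaussianShiftDensity v).comp measurable_snd
  have hρ0 : ∀ p, 0 ≤ ρ p := fun p => (Real.exp_pos _).le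
  have hdens : μ.prod (gaussianReal 1 v) =
      (μ.prod (gaussianReal 0 v)).withDensity fun p => ENNReal.ofReal (ρ p) := by
    rw [gaussianReal_one_eq_withDensity hv,
      prod_withDensity_right (measurable_gaussianShiftDensity v).ennreal_ofReal]
  have hρ1 : ∫⁻ p, ENNReal.ofReal (ρ p) ∂(μ.prod (gaussianReal 0 v)) = 1 := by
    rw [← setLIntegral_univ, ← withDensity_apply _ MeasurableSet.univ, ← hdens, measure_univ]
  have hK : ∫⁻ p, ENNReal.ofReal (ρ p ^ 2) ∂(μ.prod (gaussianReal 0 v)) ≤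
      ENNReal.ofReal (Real.exp (1 / v)) := by
    rw [lintegral_prod _ (by fun_prop)]
    simp [ρ, lintegral_gaussianShiftDensity_sq hv]
  have hfin : IsFiniteMeasure ((μ.prod (gaussianReal 0 v)).withDensity
      fun p => ENNReal.ofReal (ρ p)) := isFiniteMeasure_withDensity (by simp [hρ1])
  rw [h0, h1, hdens]
  refine ⟨(add_le_add_left (InformationTheory.klDiv_map_le _ _ hΦ) 1).trans
    (klDiv_withDensity_add_one_le hρ hρ0 hρ1 hK), fun A hA => ?_⟩
  rw [Measure.map_apply hΦ hA, Measure.map_apply hΦ hA]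
  exact withDensity_sq_le hρ hK hρ0 (hΦ hA)

/-- Path laws whose drifts differ by `c` have `χ²`-divergence at most `exp (n ‖c‖²) - 1`; stated
through its two consequences for the Kullback–Leibler divergence and for single events. -/
theorem pathLaw_divergence_bounds {Ω : Type*} [MeasurableSpace Ω] {P : Measure Ω} {W : ℝ≥0 → Ω → ℝ}
    (hW : IsBrownianReal W P) {n : ℕ} (hn : 0 < n) {f g : ℝ → ℝ}
    (hf : IntegrableOn (fun x => arcsinLink (f x)) (Ioc 0 1))
    (hg : IntegrableOn (fun x => arcsinLink (g x)) (Ioc 0 1))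
    (hfg : MemLp (fun x => arcsinLink (f x) - arcsinLink (g x)) 2 (volume.restrict (Ioc 0 1)))
    {K : ℝ} (hK : n * ∫ x in Ioc 0 1, (arcsinLink (f x) - arcsinLink (g x)) ^ 2 ≤ K) :
    IsProbabilityMeasure (pathLaw P W n f) ∧
    InformationTheory.klDiv (pathLaw P W n f) (pathLaw P W n g) + 1 ≤ ENNReal.ofReal (Real.exp K) ∧
      ∀ A : Set (unitInterval → ℝ), MeasurableSet A →
        pathLaw P W n f A ^ 2 ≤ ENNReal.ofReal (Real.exp K) * pathLaw P W n g A := by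
  have hprob : IsProbabilityMeasure P := hW.isGaussianProcess.isProbabilityMeasure
  have hn' : (0 : ℝ) < n := by exact_mod_cast hn
  obtain ⟨W', hW'm, hWW'⟩ := exists_measurable_indistinguishable hW
  have hW' : IsPreBrownianReal W' P :=
    hW.toIsPreBrownianReal.congr fun t => hWW'.mono fun ω h => h t
  have hlaw : ∀ f, pathLaw P W n f = pathLaw P W' n f := fun f => by
    refine Measure.map_congr (hWW'.mono fun ω h => ?_)
    ext t
    simp only [observedPath, h]
  simp only [hlaw]
  have hpr : ∀ f, IsProbabilityMeasure (pathLaw P W' n f) := fun f =>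
    Measure.isProbabilityMeasure_map (measurable_observedPath hW'm n f).aemeasurable
  refine ⟨hpr f, ?_⟩
  set c : ℝ → ℝ := fun x => arcsinLink (f x) - arcsinLink (g x) with hc
  set m : unitInterval → ℝ := fun t => ∫ s in (0 : ℝ)..t, c s with hm
  have hdrift : ∀ t : unitInterval, ∫ s in (0 : ℝ)..t, arcsinLink (f s) =
      (∫ s in (0 : ℝ)..t, arcsinLink (g s)) + m t := by
    intro t
    have hI : ∀ φ : ℝ → ℝ, IntegrableOn φ (Ioc 0 1) → IntervalIntegrable φ volume 0 t := by
      intro φ h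
      rw [intervalIntegrable_iff_integrableOn_Ioc_of_le t.2.1]
      exact h.mono_set (Ioc_subset_Ioc_right t.2.2)
    rw [hm, hc]
    simp only
    rw [intervalIntegral.integral_sub (hI _ hf) (hI _ hg)]
    ring
  obtain ⟨X, hXm, hXG, hX0, hXv, hXc⟩ := exists_wienerIntegral hW' c hfg
  have hXlaw : HasGaussianLaw X P := hXG.hasGaussianLaw_eval (Sum.inr ())
  have hX2 : MemLp X 2 P := hXlaw.memLp_two
  have hW2 : ∀ t, MemLp (W' t) 2 P := fun t => (hW'.isGaussianProcess.hasGaussianLaw_eval t).memLp_two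
  set s : ℝ := Var[X; P] with hs
  have hs0 : 0 ≤ s := variance_nonneg _ _
  have hnK : n * s ≤ K := le_trans (by gcongr) hK
  rcases hs0.eq_or_lt with hsz | hspos
  · -- if `X` is degenerate, then `m = cov(X, W) = 0` and the two laws coincide
    have hm0 : ∀ t, m t = 0 := by
      intro t
      rw [hm]
      simp only
      rw [← hXc t]
      have hXz : X =ᵐ[P] fun _ => 0 := by
        have := ae_eq_integral_of_variance_eq_zero hX2 hsz.symm
        filter_upwards [this] with ω h
        rw [h, hX0]
      rw [covariance_eq_sub hX2 (hW2 _), hX0, zero_mul, sub_zero]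
      rw [integral_eq_zero_of_ae]
      filter_upwards [hXz] with ω h
      simp [h]
    have heq : pathLaw P W' n f = pathLaw P W' n g := by
      unfold pathLaw
      congr 1
      ext ω t
      simp only [observedPath, hdrift, hm0, add_zero]
    have hpg := hpr g
    have hexp : (1 : ℝ≥0∞) ≤ ENNReal.ofReal (Real.exp K) := by
      rw [← ENNReal.ofReal_one]
      refine ENNReal.ofReal_le_ofReal (Real.one_le_exp ?_)
      rwa [← hsz, mul_zero] at hnK
    rw [heq, InformationTheory.klDiv_self, zero_add]
    refine ⟨hexp, fun A _ => ?_⟩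
    calc pathLaw P W' n g A ^ 2 = pathLaw P W' n g A * pathLaw P W' n g A := sq _
      _ ≤ ENNReal.ofReal (Real.exp K) * pathLaw P W' n g A := by
        gcongr
        exact prob_le_one.trans hexp
  · -- split off from `W` its regression on `X`
    set σ : ℝ := (Real.sqrt n)⁻¹ with hσ
    have hσ2 : σ ^ 2 = (n : ℝ)⁻¹ := by rw [hσ, inv_pow, Real.sq_sqrt hn'.le]
    set ξ : Ω → ℝ := fun ω => σ / s * X ω
    have hξ : Measurable ξ := hXm.const_mul _
    set V : unitInterval → Ω → ℝ := fun t ω =>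
      (∫ u in (0 : ℝ)..t, arcsinLink (g u)) +
        σ * (W' (unitInterval.toNNReal t) ω - m t / s * X ω) with hV
    have hVm : ∀ t, Measurable (V t) := fun t =>
      measurable_const.add (((hW'm _).sub (hXm.const_mul _)).const_mul _)
    obtain ⟨v, hvdef⟩ : ∃ v : ℝ≥0, (v : ℝ) = (n * s)⁻¹ := ⟨⟨(n * s)⁻¹, by positivity⟩, rfl⟩
    have hv : v ≠ 0 := by
      rw [← NNReal.coe_ne_zero, hvdef]; positivity
    have hξlaw : P.map ξ = gaussianReal 0 v := by
      have hX' : HasLaw X (gaussianReal 0 s.toNNReal) P :=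
        ⟨hXm.aemeasurable, by rw [hXlaw.map_eq_gaussianReal, hX0]⟩
      rw [(gaussianReal_const_mul hX' (σ / s)).map_eq]
      congr 1
      · simp
      · ext
        rw [NNReal.coe_mul, NNReal.coe_mk, Real.coe_toNNReal _ hs0, hvdef, div_pow, hσ2]
        field_simp
    have hind0 : IndepFun
        (fun ω (t : unitInterval) => W' (unitInterval.toNNReal t) ω - m t / s * X ω)
        (fun ω (_ : Unit) => X ω) P := by
      refine IsGaussianProcess.indepFun_of_covariance_eq_zero
        (X := fun (t : unitInterval) ω => W' (unitInterval.toNNReal t) ω - m t / s * X ω)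
        (Y := fun (_ : Unit) ω => X ω) ?_ (fun t => ?_) (fun _ => hXm.aemeasurable) fun t _ => ?_
      · refine hXG.of_isGaussianProcess ?_
        classical
        rintro (t | u)
        · refine ⟨{Sum.inl t, Sum.inr ()}, ContinuousLinearMap.proj ⟨Sum.inl t, by simp⟩ -
            (m t / s) • ContinuousLinearMap.proj ⟨Sum.inr (), by simp⟩, fun ω => ?_⟩
          simp
        · exact ⟨{Sum.inr ()}, ContinuousLinearMap.proj ⟨Sum.inr (), by simp⟩, fun ω => by simp⟩
      · exact ((hW'm _).sub (hXm.const_mul _)).aemeasurable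
      · rw [covariance_fun_sub_left (hW2 _) (hX2.const_mul _) hX2, covariance_const_mul_left,
          covariance_comm, hXc t, covariance_self hXm.aemeasurable, ← hs]
        field_simp
        simp [hm]
    have hind : IndepFun (fun ω t => V t ω) ξ P := by
      refine hind0.comp (φ := fun p (t : unitInterval) => (∫ u in (0 : ℝ)..t, arcsinLink (g u)) + σ * p t)
        (ψ := fun q => σ / s * q ()) ?_ ?_
      · exact measurable_pi_lambda _ fun t =>
          measurable_const.add ((measurable_pi_apply t).const_mul _)
      · exact (measurable_pi_apply ()).const_mul _
    have hmain := divergence_of_independent_gaussian_direction hv m hVm hξ hξlaw hind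
    have hg' : pathLaw P W' n g = P.map fun ω t => V t ω + ξ ω * m t := by
      unfold pathLaw
      congr 1
      ext ω t
      simp only [observedPath, hV, ξ]
      ring
    have hf' : pathLaw P W' n f = P.map fun ω t => V t ω + (ξ ω + 1) * m t := by
      unfold pathLaw
      congr 1
      ext ω t
      simp only [observedPath, hV, ξ, hdrift]
      ring
    have hexp : ENNReal.ofReal (Real.exp (1 / v)) ≤ ENNReal.ofReal (Real.exp K) := by
      refine ENNReal.ofReal_le_ofReal (Real.exp_le_exp.2 (le_trans (le_of_eq ?_) hnK))
      simp [hvdef]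
    rw [hf', hg']
    exact ⟨hmain.1.trans hexp, fun A hA => (hmain.2 A hA).trans (by gcongr)⟩

/-! ### The norms -/

lemma strictFloor_lt {β : ℝ} (hβ : 0 < β) : (strictFloor β : ℝ) < β := by
  unfold strictFloor
  have h := Nat.ceil_lt_add_one hβ.le
  have h1 : 1 ≤ ⌈β⌉₊ := Nat.one_le_iff_ne_zero.2 (Nat.ceil_pos.2 hβ).ne'
  rw [Nat.cast_sub h1]
  push_cast
  linarith

lemma le_strictFloor_add_one (β : ℝ) : β ≤ strictFloor β + 1 := by
  unfold strictFloor
  have h : β ≤ ⌈β⌉₊ := Nat.le_ceil β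
  have h1 : (⌈β⌉₊ : ℝ) ≤ ((⌈β⌉₊ - 1 + 1 : ℕ) : ℝ) := by
    exact_mod_cast (by omega : ⌈β⌉₊ ≤ ⌈β⌉₊ - 1 + 1)
  push_cast at h1
  linarith

lemma le_strictFloor {β : ℝ} {j : ℕ} (hj : (j : ℝ) < β) : j ≤ strictFloor β := by
  have := Nat.lt_ceil.2 hj
  unfold strictFloor
  omega

lemma flatSeminorm_le_ofReal_iff {β a : ℝ} (hβ : 0 < β) (ha : 0 ≤ a) (f : ℝ → ℝ) :
    flatSeminorm β f ≤ ENNReal.ofReal a ↔ ∀ j : ℕ, 1 ≤ j → (j : ℝ) < β → ∀ x ∈ Icc (0 : ℝ) 1,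
      |unitDeriv j f x| ≤ a ^ (j / β) * |f x| ^ (1 - j / β) := by
  unfold flatSeminorm
  simp only [iSup_le_iff]
  refine forall_congr' fun j => forall_congr' fun hj => forall_congr' fun hjβ => ?_
  have hj0 : (0 : ℝ) < j := by exact_mod_cast hj
  rw [one_div, ENNReal.rpow_inv_le_iff hj0]
  simp only [iSup_le_iff]
  refine forall_congr' fun x => forall_congr' fun _ => ?_
  rw [ENNReal.ofReal_rpow_of_nonneg ha hj0.le,
    ENNReal.div_le_iff_le_mul (Or.inr ENNReal.ofReal_ne_top) (Or.inl ENNReal.ofReal_ne_top),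
    ← ENNReal.ofReal_mul (by positivity), ENNReal.ofReal_le_ofReal_iff (by positivity),
    ← Real.le_rpow_inv_iff_of_pos (abs_nonneg _) (by positivity) hβ,
    Real.mul_rpow (by positivity) (by positivity), ← Real.rpow_mul ha,
    ← Real.rpow_mul (abs_nonneg _)]
  have : (β - j) * β⁻¹ = 1 - j / β := by field_simp
  rw [this, div_eq_mul_inv]

lemma holderNorm_of_contDiffOn {β : ℝ} {f : ℝ → ℝ}
    (hf : ContDiffOn ℝ (strictFloor β : ℕ) f (Icc 0 1)) : holderNorm β f =
      unitSupNorm f + unitSupNorm (unitDeriv (strictFloor β) f) + holderSeminorm β f := by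
  rw [holderNorm, if_pos hf]

lemma contDiffOn_of_holderNorm_ne_top {β : ℝ} {f : ℝ → ℝ} (h : holderNorm β f ≠ ∞) :
    ContDiffOn ℝ (strictFloor β : ℕ) f (Icc 0 1) := by
  by_contra h'
  exact h (if_neg h')

lemma unitDeriv_add {j k : ℕ} (hj : j ≤ k) {f g : ℝ → ℝ} (hf : ContDiffOn ℝ k f (Icc 0 1))
    (hg : ContDiffOn ℝ k g (Icc 0 1)) {x : ℝ} (hx : x ∈ Icc (0 : ℝ) 1) :
    unitDeriv j (fun x => f x + g x) x = unitDeriv j f x + unitDeriv j g x := by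
  have hj' : ((j : ℕ) : WithTop ℕ∞) ≤ k := by exact_mod_cast hj
  exact iteratedDerivWithin_fun_add hx uniqueDiffOn_Icc_zero_one
    ((hf.contDiffWithinAt hx).of_le hj') ((hg.contDiffWithinAt hx).of_le hj')

lemma unitDeriv_neg (j : ℕ) (f : ℝ → ℝ) (x : ℝ) :
    unitDeriv j (fun x => -f x) x = -unitDeriv j f x := by
  exact iteratedDerivWithin_fun_neg f

lemma unitSupNorm_add_le {f g h : ℝ → ℝ} (hfg : ∀ x ∈ Icc (0 : ℝ) 1, h x = f x + g x) :
    unitSupNorm h ≤ unitSupNorm f + unitSupNorm g := by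
  refine iSup₂_le fun x hx => ?_
  rw [hfg x hx]
  refine (ENNReal.ofReal_le_ofReal (abs_add_le _ _)).trans (ENNReal.ofReal_add_le.trans ?_)
  exact add_le_add (le_iSup₂_of_le x hx le_rfl) (le_iSup₂_of_le x hx le_rfl)

lemma holderNorm_add_le (β : ℝ) (f g : ℝ → ℝ) :
    holderNorm β (fun x => f x + g x) ≤ holderNorm β f + holderNorm β g := by
  by_cases hf : holderNorm β f = ∞
  · simp [hf]
  by_cases hg : holderNorm β g = ∞
  · simp [hg]
  replace hf := contDiffOn_of_holderNorm_ne_top hf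
  replace hg := contDiffOn_of_holderNorm_ne_top hg
  have hD : ∀ x ∈ Icc (0 : ℝ) 1, unitDeriv (strictFloor β) (fun x => f x + g x) x =
      unitDeriv (strictFloor β) f x + unitDeriv (strictFloor β) g x :=
    fun x hx => unitDeriv_add le_rfl hf hg hx
  rw [holderNorm_of_contDiffOn hf, holderNorm_of_contDiffOn hg,
    holderNorm_of_contDiffOn (hf.add hg)]
  have hS : holderSeminorm β (fun x => f x + g x) ≤ holderSeminorm β f + holderSeminorm β g := by
    refine iSup₂_le fun x hx => iSup₂_le fun y hy => iSup_le fun hxy => ?_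
    rw [hD x hx, hD y hy]
    refine le_trans (ENNReal.ofReal_le_ofReal (?_ : _ ≤
      |unitDeriv (strictFloor β) f x - unitDeriv (strictFloor β) f y| /
        |x - y| ^ (β - (strictFloor β : ℝ)) +
      |unitDeriv (strictFloor β) g x - unitDeriv (strictFloor β) g y| /
        |x - y| ^ (β - (strictFloor β : ℝ)))) (ENNReal.ofReal_add_le.trans ?_)
    · rw [← add_div]
      gcongr
      rw [add_sub_add_comm]
      exact abs_add_le _ _
    · exact add_le_add
        (le_iSup₂_of_le x hx (le_iSup₂_of_le y hy (le_iSup_of_le hxy le_rfl)))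
        (le_iSup₂_of_le x hx (le_iSup₂_of_le y hy (le_iSup_of_le hxy le_rfl)))
  calc _ ≤ (unitSupNorm f + unitSupNorm g) + (unitSupNorm (unitDeriv (strictFloor β) f) +
        unitSupNorm (unitDeriv (strictFloor β) g)) + (holderSeminorm β f + holderSeminorm β g) :=
      add_le_add (add_le_add (unitSupNorm_add_le fun _ _ => rfl) (unitSupNorm_add_le hD)) hS
    _ = _ := by ring

lemma holderNorm_neg (β : ℝ) (f : ℝ → ℝ) : holderNorm β (fun x => -f x) = holderNorm β f := by
  have h : ContDiffOn ℝ (strictFloor β : ℕ) (fun x => -f x) (Icc 0 1) ↔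
      ContDiffOn ℝ (strictFloor β : ℕ) f (Icc 0 1) :=
    ⟨fun h => by simpa using h.neg, fun h => h.neg⟩
  have hS : unitSupNorm (fun x => -f x) = unitSupNorm f := by simp [unitSupNorm]
  have hD : unitSupNorm (unitDeriv (strictFloor β) fun x => -f x) =
      unitSupNorm (unitDeriv (strictFloor β) f) := by simp [unitSupNorm, unitDeriv_neg]
  have hH : holderSeminorm β (fun x => -f x) = holderSeminorm β f := by
    simp only [holderSeminorm, unitDeriv_neg, neg_sub_neg]
    refine iSup_congr fun x => iSup_congr fun _ => iSup_congr fun y => iSup_congr fun _ =>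
      iSup_congr fun _ => ?_
    rw [abs_sub_comm (unitDeriv _ f _)]
  by_cases hc : ContDiffOn ℝ (strictFloor β : ℕ) f (Icc 0 1)
  · rw [holderNorm_of_contDiffOn hc, holderNorm_of_contDiffOn (h.2 hc), hS, hD, hH]
  · rw [holderNorm, if_neg (h.not.2 hc), holderNorm, if_neg hc]

/-- For `β ≤ 1` the Hölder norm controls `β`-Hölder increments. -/
lemma abs_sub_le_of_holderNorm_le {β A : ℝ} (hβ : 0 < β) (hβ1 : β ≤ 1) (hA : 0 ≤ A) {f : ℝ → ℝ}
    (hf : holderNorm β f ≤ ENNReal.ofReal A) {x y : ℝ} (hx : x ∈ Icc (0 : ℝ) 1)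
    (hy : y ∈ Icc (0 : ℝ) 1) : |f x - f y| ≤ A * |x - y| ^ β := by
  rcases eq_or_ne x y with rfl | hxy
  · simp [hβ.ne']
  have h0 : strictFloor β = 0 := by
    have := strictFloor_lt hβ
    have h1 : (strictFloor β : ℝ) < 1 := this.trans_le hβ1
    exact_mod_cast Nat.lt_one_iff.1 (by exact_mod_cast h1)
  rw [holderNorm_of_contDiffOn
    (contDiffOn_of_holderNorm_ne_top (ne_top_of_le_ne_top ENNReal.ofReal_ne_top hf))] at hf
  have h1 : holderSeminorm β f ≤ ENNReal.ofReal A := le_trans le_add_self hf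
  have h2 := (iSup₂_le_iff.1 ((iSup₂_le_iff.1 h1) x hx)) y hy
  have h3 := (iSup_le_iff.1 h2) hxy
  have hpos : 0 < |x - y| := abs_pos.2 (sub_ne_zero.2 hxy)
  rw [ENNReal.ofReal_le_ofReal_iff hA, h0, Nat.cast_zero, sub_zero,
    div_le_iff₀ (by positivity)] at h3
  simpa [unitDeriv] using h3

/-! ### A flat bump -/

open scoped ContDiff in
/-- The derivatives of order `j ≤ m` of `φ ^ m` carry a factor `φ ^ (m - j)`. -/
lemma exists_iteratedDeriv_pow_eq {φ : ℝ → ℝ} (hφ : ContDiff ℝ ∞ φ) (m : ℕ) :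
    ∀ j ≤ m, ∃ G : ℝ → ℝ, ContDiff ℝ ∞ G ∧
      ∀ x, iteratedDeriv j (fun x => φ x ^ m) x = φ x ^ (m - j) * G x := by
  have hd : ∀ {g : ℝ → ℝ}, ContDiff ℝ ∞ g → Differentiable ℝ g ∧ ContDiff ℝ ∞ (deriv g) :=
    fun h => contDiff_infty_iff_deriv.1 h
  intro j
  induction j with
  | zero => exact fun _ => ⟨fun _ => 1, contDiff_const, fun x => by simp⟩
  | succ j ih =>
    intro hj
    obtain ⟨G, hG, hGe⟩ := ih (by omega)
    refine ⟨fun x => (m - j : ℕ) * deriv φ x * G x + φ x * deriv G x, ?_, fun x => ?_⟩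
    · exact ((contDiff_const.mul (hd hφ).2).mul hG).add (hφ.mul (hd hG).2)
    · rw [iteratedDeriv_succ, funext hGe]
      have h1 : HasDerivAt (fun x => φ x ^ (m - j) * G x)
          ((m - j : ℕ) * φ x ^ (m - j - 1) * deriv φ x * G x + φ x ^ (m - j) * deriv G x) x :=
        (((hd hφ).1 x).hasDerivAt.pow (m - j)).mul ((hd hG).1 x).hasDerivAt
      rw [h1.deriv]
      have h2 : m - j = (m - (j + 1)) + 1 := by omega
      have h3 : φ x ^ (m - j) = φ x ^ (m - (j + 1)) * φ x := by rw [h2, pow_succ]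
      have h4 : m - j - 1 = m - (j + 1) := by omega
      rw [h3, h4]
      ring

open scoped ContDiff in
/-- A smooth kernel supported in `[-1, 1]` whose derivatives of order `j < β` are dominated by the
power `1 - j / β` of the kernel. It is a high power of a bump function. -/
lemma exists_flat_kernel {β : ℝ} (hβ : 0 < β) :
    ∃ (K : ℝ → ℝ) (M : ℝ), 0 < M ∧ ContDiff ℝ ∞ K ∧ (∀ x, 0 ≤ K x) ∧ (∀ x, K x ≤ 1) ∧ K 0 = 1 ∧
      (∀ x, 1 ≤ |x| → K x = 0) ∧
      (∀ j ≤ strictFloor β + 1, ∀ x, |iteratedDeriv j K x| ≤ M) ∧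
      ∀ j : ℕ, (j : ℝ) < β → ∀ x, |iteratedDeriv j K x| ≤ M * K x ^ (1 - j / β) := by
  let φ : ContDiffBump (0 : ℝ) := ⟨1 / 2, 1, by norm_num, by norm_num⟩
  set m := strictFloor β + 2 with hm
  have hmβ : β ≤ m := by
    have := le_strictFloor_add_one β
    rw [hm]; push_cast; linarith
  have hφ : ContDiff ℝ ∞ φ := φ.contDiff
  have hφ0 : ∀ x, 1 ≤ |x| → φ x = 0 := fun x hx => φ.zero_of_le_dist (by simpa [φ] using hx)
  have hfac : ∀ j ≤ strictFloor β + 1, ∃ M, 0 ≤ M ∧ ∀ x,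
      |iteratedDeriv j (fun x => φ x ^ m) x| ≤ M * φ x ^ (m - j) := by
    intro j hj
    obtain ⟨G, hG, hGe⟩ := exists_iteratedDeriv_pow_eq hφ m j (by omega)
    obtain ⟨M, hM⟩ := (isCompact_Icc (a := (-1 : ℝ)) (b := 1)).exists_bound_of_continuousOn
      hG.continuous.continuousOn
    refine ⟨|M|, abs_nonneg _, fun x => ?_⟩
    have h0 : 0 ≤ φ x ^ (m - j) := pow_nonneg φ.nonneg _
    rw [hGe, abs_mul, abs_of_nonneg h0, mul_comm]
    rcases le_or_gt 1 |x| with hx | hx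
    · rw [hφ0 x hx, zero_pow (by omega)]; simp
    · exact mul_le_mul_of_nonneg_right
        ((hM x (abs_le.1 hx.le)).trans (le_abs_self M)) h0
  choose! Mf hMf0 hMf using hfac
  set M := 1 + ∑ j ∈ Finset.range (strictFloor β + 2), Mf j with hMdef
  have hMf_le : ∀ j ≤ strictFloor β + 1, Mf j ≤ M := by
    intro j hj
    have := Finset.single_le_sum (f := Mf) (s := Finset.range (strictFloor β + 2))
      (fun i hi => hMf0 i (by simpa using Nat.lt_succ_iff.1 (Finset.mem_range.1 hi)))
      (Finset.mem_range.2 (Nat.lt_succ_of_le hj))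
    linarith
  have hMpos : 0 < M := by
    have := Finset.sum_nonneg (f := Mf) (s := Finset.range (strictFloor β + 2))
      fun i hi => hMf0 i (by simpa using Nat.lt_succ_iff.1 (Finset.mem_range.1 hi))
    linarith
  have hmain : ∀ j ≤ strictFloor β + 1, ∀ x,
      |iteratedDeriv j (fun x => φ x ^ m) x| ≤ M * φ x ^ (m - j) := fun j hj x =>
    (hMf j hj x).trans (mul_le_mul_of_nonneg_right (hMf_le j hj) (pow_nonneg φ.nonneg _))
  refine ⟨fun x => φ x ^ m, M, hMpos, hφ.pow m, fun x => pow_nonneg φ.nonneg _,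
    fun x => pow_le_one₀ φ.nonneg φ.le_one, ?_, fun x hx => ?_, fun j hj x => ?_, fun j hj x => ?_⟩
  · have : φ 0 = 1 := φ.one_of_mem_closedBall (by simp [φ])
    simp [this]
  · simp only
    rw [hφ0 x hx, zero_pow (by omega)]
  · exact (hmain j hj x).trans
      (mul_le_of_le_one_right hMpos.le (pow_le_one₀ φ.nonneg φ.le_one))
  · have hj' := le_strictFloor hj
    refine (hmain j (by omega) x).trans (mul_le_mul_of_nonneg_left ?_ hMpos.le)
    simp only
    rw [← Real.rpow_natCast, ← Real.rpow_natCast, ← Real.rpow_mul φ.nonneg]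
    have hjβ : (j : ℝ) / β < 1 := (div_lt_one hβ).2 hj
    refine Real.rpow_le_rpow_of_exponent_ge' φ.nonneg φ.le_one
      (mul_nonneg (Nat.cast_nonneg _) (by linarith)) ?_
    rw [Nat.cast_sub (by omega), mul_sub, mul_one, sub_le_sub_iff_left]
    rw [← mul_div_assoc, le_div_iff₀ hβ, mul_comm]
    gcongr

open scoped ContDiff in
/-- The rescaled kernel `ψ = η b ^ β K ((· - x₀) / b)`: its Hölder norm and its flatness constants
are small with `η`, uniformly in the centre `x₀` and the bandwidth `b ≤ 1`. -/
lemma exists_flat_bump {β : ℝ} (hβ : 0 < β) :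
    ∃ M : ℝ, 0 < M ∧ ∀ x₀ η b : ℝ, 0 < η → 0 < b → b ≤ 1 → ∃ ψ : ℝ → ℝ, ContDiff ℝ ∞ ψ ∧
      (∀ x, 0 ≤ ψ x) ∧ (∀ x, ψ x ≤ η * b ^ β) ∧ ψ x₀ = η * b ^ β ∧
      (∀ x, b ≤ |x - x₀| → ψ x = 0) ∧
      (∀ j : ℕ, (j : ℝ) < β → ∀ x ∈ Icc (0 : ℝ) 1,
        |unitDeriv j ψ x| ≤ M * η ^ (j / β) * ψ x ^ (1 - j / β)) ∧
      holderNorm β ψ ≤ ENNReal.ofReal (M * η) := by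
  obtain ⟨K, M, hM, hK, hK0, hK1, hK01, hKs, hKb, hKf⟩ := exists_flat_kernel hβ
  refine ⟨1 + 3 * M, by positivity, fun x₀ η b hη hb hb1 => ?_⟩
  set k := strictFloor β with hk
  set ψ : ℝ → ℝ := fun x => η * b ^ β * K (b⁻¹ * (x - x₀)) with hψ
  have hbβ : 0 < b ^ β := Real.rpow_pos_of_pos hb β
  have hψs : ContDiff ℝ ∞ ψ :=
    contDiff_const.mul (hK.comp (contDiff_const.mul (contDiff_id.sub contDiff_const)))
  have hder : ∀ j : ℕ, ∀ x ∈ Icc (0 : ℝ) 1,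
      unitDeriv j ψ x = η * b ^ (β - j) * iteratedDeriv j K (b⁻¹ * (x - x₀)) := by
    intro j x hx
    rw [unitDeriv, iteratedDerivWithin_eq_iteratedDeriv uniqueDiffOn_Icc_zero_one
      (hψs.contDiffAt.of_le (by exact_mod_cast le_top)) hx]
    have h1 : ψ = fun x => (fun y => η * b ^ β * (fun z => K (b⁻¹ * z)) y) (x - x₀) := rfl
    rw [h1, congrFun (iteratedDeriv_comp_sub_const j
      (fun y => η * b ^ β * (fun z => K (b⁻¹ * z)) y) x₀) x, iteratedDeriv_const_mul_field,
      iteratedDeriv_comp_const_mul (hK.of_le (by exact_mod_cast le_top))]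
    rw [Real.rpow_sub hb, Real.rpow_natCast]
    simp only [inv_pow]
    field_simp
  have hle : ∀ x, ψ x ≤ η * b ^ β := fun x => mul_le_of_le_one_right (by positivity) (hK1 _)
  have hnn : ∀ x, 0 ≤ ψ x := fun x => mul_nonneg (by positivity) (hK0 _)
  have hkβ : (k : ℝ) < β := strictFloor_lt hβ
  have hbk : b ^ (β - k) ≤ 1 := Real.rpow_le_one hb.le hb1 (by linarith)
  have hbβ1 : b ^ β ≤ 1 := Real.rpow_le_one hb.le hb1 hβ.le
  refine ⟨ψ, hψs, hnn, hle, by simp [hψ, hK01], fun x hx => ?_, fun j hj x hx => ?_, ?_⟩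
  · rw [hψ]
    simp only
    rw [hKs, mul_zero]
    rw [abs_mul, abs_inv, abs_of_pos hb, inv_mul_eq_div]
    exact (one_le_div hb).2 hx
  · have hjβ : (j : ℝ) / β < 1 := (div_lt_one hβ).2 hj
    rw [hder j x hx, abs_mul, abs_of_nonneg (by positivity)]
    have hpow : ψ x ^ (1 - j / β) =
        η ^ (1 - j / β) * b ^ (β - j) * K (b⁻¹ * (x - x₀)) ^ (1 - j / β) := by
      rw [hψ]
      simp only
      rw [Real.mul_rpow (by positivity) (hK0 _), Real.mul_rpow hη.le hbβ.le, ← Real.rpow_mul hb.le]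
      congr 3
      field_simp
    have hη1 : η ^ (j / β) * η ^ (1 - j / β) = η := by
      rw [← Real.rpow_add hη]; simp
    calc η * b ^ (β - j) * |iteratedDeriv j K (b⁻¹ * (x - x₀))|
        ≤ η * b ^ (β - j) * (M * K (b⁻¹ * (x - x₀)) ^ (1 - j / β)) := by
          gcongr
          exact hKf j hj _
      _ = M * η ^ (j / β) * ψ x ^ (1 - j / β) := by
          rw [hpow]
          nth_rewrite 1 [← hη1]
          ring
      _ ≤ _ := by
          have := Real.rpow_nonneg (hnn x) (1 - j / β)
          gcongr
          linarith
  · rw [holderNorm_of_contDiffOn (hψs.contDiffOn.of_le (by exact_mod_cast le_top))]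
    have h1 : unitSupNorm ψ ≤ ENNReal.ofReal η := by
      refine iSup₂_le fun x _ => ENNReal.ofReal_le_ofReal ?_
      rw [abs_of_nonneg (hnn x)]
      exact (hle x).trans (mul_le_of_le_one_right hη.le hbβ1)
    have h2 : unitSupNorm (unitDeriv k ψ) ≤ ENNReal.ofReal (M * η) := by
      refine iSup₂_le fun x hx => ENNReal.ofReal_le_ofReal ?_
      rw [hder k x hx, abs_mul, abs_of_nonneg (by positivity), mul_comm]
      gcongr
      · exact hKb k (by omega) _
      · exact mul_le_of_le_one_right hη.le hbk
    have h3 : holderSeminorm β ψ ≤ ENNReal.ofReal (2 * M * η) := by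
      refine iSup₂_le fun x hx => iSup₂_le fun y hy => iSup_le fun hxy =>
        ENNReal.ofReal_le_ofReal ?_
      have hpos : 0 < |x - y| := abs_pos.2 (sub_ne_zero.2 hxy)
      rw [← hk, div_le_iff₀ (by positivity), hder k x hx, hder k y hy, ← mul_sub, abs_mul,
        abs_of_nonneg (by positivity)]
      set u := b⁻¹ * (x - x₀)
      set w := b⁻¹ * (y - x₀)
      have huw : |u - w| = |x - y| / b := by
        have : u - w = b⁻¹ * (x - y) := by simp only [u, w]; ring
        rw [this, abs_mul, abs_inv, abs_of_pos hb, inv_mul_eq_div]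
      have hs0 : 0 < β - k := by linarith
      have hs1 : β - k ≤ 1 := by linarith [le_strictFloor_add_one β]
      -- interpolate between the supremum bound and the Lipschitz bound of the `k`-th derivative
      have hinterp : |iteratedDeriv k K u - iteratedDeriv k K w| ≤ 2 * M * |u - w| ^ (β - k) := by
        have huw0 : 0 < |u - w| := by rw [huw]; positivity
        rcases le_total |u - w| 1 with h | h
        · have hlip : |iteratedDeriv k K u - iteratedDeriv k K w| ≤ M * |u - w| := by
            have := Convex.norm_image_sub_le_of_norm_deriv_le (f := iteratedDeriv k K) (s := univ)
              (C := M) (x := w) (y := u) (fun z _ => ?_) (fun z _ => ?_) convex_univ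
              (mem_univ _) (mem_univ _)
            · simpa [Real.norm_eq_abs] using this
            · exact (hK.differentiable_iteratedDeriv k (by exact_mod_cast WithTop.coe_lt_top _)) z
            · rw [← iteratedDeriv_succ]
              exact hKb (k + 1) le_rfl z
          have h' : |u - w| ≤ |u - w| ^ (β - k) := by
            conv_lhs => rw [← Real.rpow_one |u - w|]
            exact Real.rpow_le_rpow_of_exponent_ge huw0 h hs1
          nlinarith
        · have h' : 1 ≤ |u - w| ^ (β - k) := Real.one_le_rpow h hs0.le
          have hu := hKb k (by omega) u
          have hw := hKb k (by omega) w
          have := abs_sub (iteratedDeriv k K u) (iteratedDeriv k K w)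
          nlinarith
      calc η * b ^ (β - k) * |iteratedDeriv k K u - iteratedDeriv k K w|
          ≤ η * b ^ (β - k) * (2 * M * |u - w| ^ (β - k)) := by gcongr
        _ = 2 * M * η * |x - y| ^ (β - k) := by
          rw [huw, Real.div_rpow hpos.le hb.le]
          field_simp
    calc _ ≤ ENNReal.ofReal η + ENNReal.ofReal (M * η) + ENNReal.ofReal (2 * M * η) :=
          add_le_add (add_le_add h1 h2) h3
      _ = ENNReal.ofReal ((1 + 3 * M) * η) := by
          rw [← ENNReal.ofReal_add (by positivity) (by positivity),
            ← ENNReal.ofReal_add (by positivity) (by positivity)]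
          ring_nf

/-! ### Flat functions vary slowly -/

open Topology in
/-- For `β > 1` the flatness bound on `φ'` says that `φ ^ (1 / β)` is Lipschitz. -/
lemma rpow_le_rpow_add_of_flatSeminorm_le {β A : ℝ} (hβ : 1 < β) (hA : 0 ≤ A) {φ : ℝ → ℝ}
    (h0 : ∀ x ∈ Icc (0 : ℝ) 1, 0 ≤ φ x) (hc : ContDiffOn ℝ (strictFloor β : ℕ) φ (Icc 0 1))
    (hf : flatSeminorm β φ ≤ ENNReal.ofReal A) {x y : ℝ} (hx : x ∈ Icc (0 : ℝ) 1)
    (hy : y ∈ Icc (0 : ℝ) 1) :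
    φ x ^ (1 / β) ≤ φ y ^ (1 / β) + A ^ (1 / β) * |x - y| := by
  have hβ0 : 0 < β := by linarith
  have hflat := (flatSeminorm_le_ofReal_iff hβ0 hA φ).1 hf 1 le_rfl (by simpa using hβ)
  have hk : (1 : WithTop ℕ∞) ≤ ((strictFloor β : ℕ) : WithTop ℕ∞) := by
    exact_mod_cast le_strictFloor (j := 1) (by simpa using hβ)
  have hdiff := hc.differentiableOn (by intro h; rw [h] at hk; simp at hk)
  have hle1 : 1 / β ≤ 1 := by rw [div_le_one hβ0]; exact hβ.le
  -- the root is differentiated after adding `ε`, since `φ` may vanish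
  have hε : ∀ ε : ℝ, 0 < ε →
      φ x ^ (1 / β) ≤ (φ y + ε) ^ (1 / β) + A ^ (1 / β) * |x - y| := by
    intro ε hε
    have hLip := Convex.norm_image_sub_le_of_norm_hasDerivWithin_le
      (f := fun x => (φ x + ε) ^ (1 / β)) (s := Icc (0 : ℝ) 1) (C := A ^ (1 / β)) (x := y) (y := x)
      (f' := fun z => derivWithin φ (Icc 0 1) z * (1 / β) * (φ z + ε) ^ (1 / β - 1))
      (fun z hz => ?_) (fun z hz => ?_) (convex_Icc 0 1) hy hx
    · have h1 := (abs_le.1 (by simpa [Real.norm_eq_abs] using hLip :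
        |(φ x + ε) ^ (1 / β) - (φ y + ε) ^ (1 / β)| ≤ A ^ (1 / β) * |x - y|)).2
      have h2 : φ x ^ (1 / β) ≤ (φ x + ε) ^ (1 / β) :=
        Real.rpow_le_rpow (h0 x hx) (by linarith) (by positivity)
      linarith
    · exact ((hdiff z hz).hasDerivWithinAt.add_const ε).rpow_const
        (Or.inl (by linarith [h0 z hz] : (0 : ℝ) < φ z + ε).ne')
    · have hz0 := h0 z hz
      have hd := hflat z hz
      rw [unitDeriv, iteratedDerivWithin_one, abs_of_nonneg hz0, Nat.cast_one] at hd
      have hpos : 0 < φ z + ε := by linarith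
      have hpow : φ z ^ (1 - 1 / β) * (φ z + ε) ^ (1 / β - 1) ≤ 1 := by
        calc φ z ^ (1 - 1 / β) * (φ z + ε) ^ (1 / β - 1)
            ≤ (φ z + ε) ^ (1 - 1 / β) * (φ z + ε) ^ (1 / β - 1) := by
              gcongr
              linarith
          _ = 1 := by rw [← Real.rpow_add hpos]; simp
      rw [Real.norm_eq_abs, abs_mul, abs_mul, abs_of_nonneg (by positivity : (0 : ℝ) ≤ 1 / β),
        abs_of_nonneg (by positivity : 0 ≤ (φ z + ε) ^ (1 / β - 1))]
      have hA' : 0 ≤ A ^ (1 / β) := by positivity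
      calc |derivWithin φ (Icc 0 1) z| * (1 / β) * (φ z + ε) ^ (1 / β - 1)
          ≤ A ^ (1 / β) * φ z ^ (1 - 1 / β) * 1 * (φ z + ε) ^ (1 / β - 1) := by gcongr
        _ = A ^ (1 / β) * (φ z ^ (1 - 1 / β) * (φ z + ε) ^ (1 / β - 1)) := by ring
        _ ≤ A ^ (1 / β) := mul_le_of_le_one_right hA' hpow
  have hlim : Tendsto (fun ε : ℝ => (φ y + ε) ^ (1 / β) + A ^ (1 / β) * |x - y|) (𝓝[>] 0)
      (𝓝 ((φ y + 0) ^ (1 / β) + A ^ (1 / β) * |x - y|)) := by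
    refine Tendsto.mono_left ?_ nhdsWithin_le_nhds
    have : Continuous fun ε : ℝ => (φ y + ε) ^ (1 / β) + A ^ (1 / β) * |x - y| :=
      ((continuous_const.add continuous_id).rpow_const fun _ => Or.inr (by positivity)).add
        continuous_const
    exact this.tendsto 0
  rw [add_zero] at hlim
  exact ge_of_tendsto hlim (eventually_mem_nhdsWithin.mono hε)

/-- On the local scale `φ(x₀) ^ (1 / β)` a flat function cannot fall below half its value. -/
lemma exists_half_le_of_flat {β A : ℝ} (hβ : 0 < β) (hA : 0 ≤ A) :
    ∃ κ : ℝ, 0 < κ ∧ κ ≤ 1 ∧ ∀ φ : ℝ → ℝ, (∀ x ∈ Icc (0 : ℝ) 1, 0 ≤ φ x) →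
      ContDiffOn ℝ (strictFloor β : ℕ) φ (Icc 0 1) → flatSeminorm β φ ≤ ENNReal.ofReal A →
      (β ≤ 1 → ∀ x ∈ Icc (0 : ℝ) 1, ∀ y ∈ Icc (0 : ℝ) 1, |φ x - φ y| ≤ A * |x - y| ^ β) →
      ∀ x₀ ∈ Icc (0 : ℝ) 1, ∀ x ∈ Icc (0 : ℝ) 1, |x - x₀| ≤ κ * φ x₀ ^ (1 / β) →
        φ x₀ / 2 ≤ φ x := by
  rcases le_or_gt β 1 with hβ1 | hβ1
  · refine ⟨(1 / (2 * (A + 1))) ^ (1 / β), by positivity, ?_, ?_⟩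
    · refine Real.rpow_le_one (by positivity) ?_ (by positivity)
      rw [div_le_one (by positivity)]; linarith
    intro φ h0 _ _ hH x₀ hx₀ x hx hd
    have h1 := hH hβ1 x₀ hx₀ x hx
    have hφ0 := h0 x₀ hx₀
    have h2 : |x₀ - x| ^ β ≤ 1 / (2 * (A + 1)) * φ x₀ := by
      rw [abs_sub_comm] at hd
      calc |x₀ - x| ^ β ≤ ((1 / (2 * (A + 1))) ^ (1 / β) * φ x₀ ^ (1 / β)) ^ β :=
            Real.rpow_le_rpow (abs_nonneg _) hd hβ.le
        _ = 1 / (2 * (A + 1)) * φ x₀ := by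
            rw [← Real.mul_rpow (by positivity) hφ0, ← Real.rpow_mul (by positivity),
              one_div_mul_cancel hβ.ne', Real.rpow_one]
    have h3 : A * |x₀ - x| ^ β ≤ φ x₀ / 2 := by
      calc A * |x₀ - x| ^ β ≤ (A + 1) * (1 / (2 * (A + 1)) * φ x₀) := by
            gcongr; linarith
        _ = φ x₀ / 2 := by field_simp
    have := (abs_le.1 (h1.trans h3)).2
    linarith
  · set L := A ^ (1 / β)
    set τ : ℝ := (1 / 2) ^ (1 / β) with hτ
    have hτ0 : 0 < τ := by positivity
    have hτ1 : τ < 1 := Real.rpow_lt_one (by norm_num) (by norm_num) (by positivity)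
    have hL : 0 ≤ L := by positivity
    refine ⟨(1 - τ) / (L + 1), div_pos (by linarith) (by positivity), ?_, ?_⟩
    · rw [div_le_one (by positivity)]; linarith
    intro φ h0 hc hf _ x₀ hx₀ x hx hd
    have h1 := rpow_le_rpow_add_of_flatSeminorm_le hβ1 hA h0 hc hf hx₀ hx
    have hφ0 := h0 x₀ hx₀
    set s := φ x₀ ^ (1 / β) with hs
    have hs0 : 0 ≤ s := by positivity
    have h2 : L * |x₀ - x| ≤ (1 - τ) * s := by
      rw [abs_sub_comm] at hd
      calc L * |x₀ - x| ≤ (L + 1) * ((1 - τ) / (L + 1) * s) := by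
            gcongr
            linarith
        _ = (1 - τ) * s := by field_simp
    have h3 : τ * s ≤ φ x ^ (1 / β) := by linarith
    have h4 := Real.rpow_le_rpow (by positivity) h3 hβ.le
    rw [hτ, hs, ← Real.mul_rpow (by norm_num) hφ0, ← Real.rpow_mul (by positivity),
      ← Real.rpow_mul (h0 x hx), one_div_mul_cancel hβ.ne', Real.rpow_one, Real.rpow_one] at h4
    linarith

/-! ### Flatness of perturbed functions -/

lemma flatSeminorm_add_le_of_flat {β a a' : ℝ} {B : ℕ → ℝ} (hβ : 0 < β) (ha : 0 ≤ a) (ha' : 0 ≤ a')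
    {φ ψ : ℝ → ℝ} (hφ0 : ∀ x ∈ Icc (0 : ℝ) 1, 0 ≤ φ x) (hψ0 : ∀ x, 0 ≤ ψ x) (hB : ∀ j, 0 ≤ B j)
    (hφc : ContDiffOn ℝ (strictFloor β : ℕ) φ (Icc 0 1))
    (hψc : ContDiffOn ℝ (strictFloor β : ℕ) ψ (Icc 0 1))
    (hφ : flatSeminorm β φ ≤ ENNReal.ofReal a)
    (hψ : ∀ j : ℕ, (j : ℝ) < β → ∀ x ∈ Icc (0 : ℝ) 1,
      |unitDeriv j ψ x| ≤ B j * ψ x ^ (1 - j / β))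
    (hab : ∀ j : ℕ, 1 ≤ j → (j : ℝ) < β → a ^ (j / β) + B j ≤ a' ^ (j / β)) :
    flatSeminorm β (fun x => φ x + ψ x) ≤ ENNReal.ofReal a' := by
  rw [flatSeminorm_le_ofReal_iff hβ ha']
  intro j hj hjβ x hx
  have h1 := (flatSeminorm_le_ofReal_iff hβ ha φ).1 hφ j hj hjβ x hx
  have h2 := hψ j hjβ x hx
  have hφx := hφ0 x hx
  have hψx := hψ0 x
  rw [abs_of_nonneg hφx] at h1
  rw [unitDeriv_add (le_strictFloor hjβ) hφc hψc hx, abs_of_nonneg (add_nonneg hφx hψx)]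
  have hq : 0 ≤ 1 - j / β := by linarith [(div_lt_one hβ).2 hjβ]
  have hBj := hB j
  calc |unitDeriv j φ x + unitDeriv j ψ x|
      ≤ a ^ (j / β) * φ x ^ (1 - j / β) + B j * ψ x ^ (1 - j / β) :=
        (abs_add_le _ _).trans (add_le_add h1 h2)
    _ ≤ a ^ (j / β) * (φ x + ψ x) ^ (1 - j / β) + B j * (φ x + ψ x) ^ (1 - j / β) := by
        gcongr <;> linarith
    _ = (a ^ (j / β) + B j) * (φ x + ψ x) ^ (1 - j / β) := by ring
    _ ≤ a' ^ (j / β) * (φ x + ψ x) ^ (1 - j / β) := by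
        gcongr
        exact hab j hj hjβ

/-- Subtracting a flat bump which is small relative to what remains of `φ`. -/
lemma flatSeminorm_sub_le_of_flat {β a a' d : ℝ} {B : ℕ → ℝ} (hβ : 0 < β) (ha : 0 ≤ a)
    (ha' : 0 ≤ a') (hd : 0 ≤ d) {φ ψ : ℝ → ℝ} (hψ0 : ∀ x, 0 ≤ ψ x) (hB : ∀ j, 0 ≤ B j)
    (hle : ∀ x ∈ Icc (0 : ℝ) 1, ψ x ≤ φ x)
    (hsmall : ∀ x ∈ Icc (0 : ℝ) 1, ψ x ≤ d * (φ x - ψ x))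
    (hφc : ContDiffOn ℝ (strictFloor β : ℕ) φ (Icc 0 1))
    (hψc : ContDiffOn ℝ (strictFloor β : ℕ) ψ (Icc 0 1))
    (hφ : flatSeminorm β φ ≤ ENNReal.ofReal a)
    (hψ : ∀ j : ℕ, (j : ℝ) < β → ∀ x ∈ Icc (0 : ℝ) 1,
      |unitDeriv j ψ x| ≤ B j * ψ x ^ (1 - j / β))
    (hab : ∀ j : ℕ, 1 ≤ j → (j : ℝ) < β →
      a ^ (j / β) + (a ^ (j / β) + B j) * d ^ (1 - j / β) ≤ a' ^ (j / β)) :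
    flatSeminorm β (fun x => φ x - ψ x) ≤ ENNReal.ofReal a' := by
  rw [flatSeminorm_le_ofReal_iff hβ ha']
  intro j hj hjβ x hx
  have h1 := (flatSeminorm_le_ofReal_iff hβ ha φ).1 hφ j hj hjβ x hx
  have h2 := hψ j hjβ x hx
  have hψx := hψ0 x
  have hlex := hle x hx
  have hr : 0 ≤ φ x - ψ x := by linarith
  rw [abs_of_nonneg (by linarith : 0 ≤ φ x)] at h1
  have hq : 0 ≤ 1 - j / β := by linarith [(div_lt_one hβ).2 hjβ]
  have hq1 : 1 - (j : ℝ) / β ≤ 1 := by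
    have : (0 : ℝ) ≤ j / β := by positivity
    linarith
  have hD : unitDeriv j (fun x => φ x - ψ x) x = unitDeriv j φ x - unitDeriv j ψ x := by
    simp_rw [sub_eq_add_neg]
    rw [unitDeriv_add (le_strictFloor hjβ) hφc hψc.neg hx, unitDeriv_neg]
  rw [hD, abs_of_nonneg hr]
  have hBj := hB j
  have hsub : φ x ^ (1 - j / β) ≤ (φ x - ψ x) ^ (1 - j / β) + ψ x ^ (1 - j / β) := by
    have := Real.rpow_add_le_add_rpow hr hψx hq hq1
    rwa [sub_add_cancel] at this
  have hψpow : ψ x ^ (1 - j / β) ≤ d ^ (1 - j / β) * (φ x - ψ x) ^ (1 - j / β) := by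
    rw [← Real.mul_rpow hd hr]
    exact Real.rpow_le_rpow hψx (hsmall x hx) hq
  calc |unitDeriv j φ x - unitDeriv j ψ x|
      ≤ a ^ (j / β) * φ x ^ (1 - j / β) + B j * ψ x ^ (1 - j / β) :=
        (abs_sub _ _).trans (add_le_add h1 h2)
    _ ≤ a ^ (j / β) * ((φ x - ψ x) ^ (1 - j / β) + ψ x ^ (1 - j / β)) +
        B j * ψ x ^ (1 - j / β) := by gcongr
    _ = a ^ (j / β) * (φ x - ψ x) ^ (1 - j / β) +
        (a ^ (j / β) + B j) * ψ x ^ (1 - j / β) := by ring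
    _ ≤ a ^ (j / β) * (φ x - ψ x) ^ (1 - j / β) +
        (a ^ (j / β) + B j) * (d ^ (1 - j / β) * (φ x - ψ x) ^ (1 - j / β)) := by gcongr
    _ = (a ^ (j / β) + (a ^ (j / β) + B j) * d ^ (1 - j / β)) * (φ x - ψ x) ^ (1 - j / β) := by
        ring
    _ ≤ a' ^ (j / β) * (φ x - ψ x) ^ (1 - j / β) := by
        gcongr
        exact hab j hj hjβ

open Topology in
/-- Bumps of small height `η` raise a flatness constant `a ≤ A` by at most `ε`, uniformly in `a`. -/
lemma eventually_flatness_budget {β A ε M : ℝ} (hβ : 0 < β) (hε : 0 < ε) (hA : 0 ≤ A) :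
    ∀ᶠ η : ℝ in 𝓝[>] 0, ∀ a ∈ Icc 0 A, ∀ j : ℕ, 1 ≤ j → (j : ℝ) < β →
      a ^ (j / β) + M * η ^ (j / β) ≤ (a + ε) ^ (j / β) ∧
      a ^ (j / β) + (a ^ (j / β) + M * η ^ (j / β)) * (8 * η) ^ (1 - j / β) ≤
        (a + ε) ^ (j / β) := by
  have key : ∀ p : ℝ, 0 < p → p < 1 → ∀ᶠ η : ℝ in 𝓝[>] 0, ∀ a ∈ Icc 0 A,
      a ^ p + M * η ^ p ≤ (a + ε) ^ p ∧
      a ^ p + (a ^ p + M * η ^ p) * (8 * η) ^ (1 - p) ≤ (a + ε) ^ p := by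
    intro p hp hp1
    obtain ⟨a₀, ha₀, hmin⟩ := (isCompact_Icc (a := (0 : ℝ)) (b := A)).exists_isMinOn
      ⟨0, by simpa using hA⟩ (f := fun a => (a + ε) ^ p - a ^ p)
      (Continuous.continuousOn (by
        exact ((continuous_id.add continuous_const).rpow_const fun _ => Or.inr hp.le).sub
          (continuous_id.rpow_const fun _ => Or.inr hp.le)))
    have hD : 0 < (a₀ + ε) ^ p - a₀ ^ p :=
      sub_pos.2 (Real.rpow_lt_rpow ha₀.1 (by linarith) hp)
    have hc1 : Continuous fun η : ℝ => M * η ^ p :=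
      continuous_const.mul (continuous_id.rpow_const fun _ => Or.inr hp.le)
    have hc2 : Continuous fun η : ℝ => (A ^ p + M * η ^ p) * (8 * η) ^ (1 - p) :=
      (continuous_const.add hc1).mul
        ((continuous_const.mul continuous_id).rpow_const fun _ => Or.inr (by linarith))
    have h1 : ∀ᶠ η : ℝ in 𝓝[>] 0, M * η ^ p < (a₀ + ε) ^ p - a₀ ^ p :=
      ((hc1.tendsto 0).mono_left nhdsWithin_le_nhds).eventually_lt_const
        (by simpa [Real.zero_rpow hp.ne'] using hD)
    have h2 : ∀ᶠ η : ℝ in 𝓝[>] 0,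
        (A ^ p + M * η ^ p) * (8 * η) ^ (1 - p) < (a₀ + ε) ^ p - a₀ ^ p :=
      ((hc2.tendsto 0).mono_left nhdsWithin_le_nhds).eventually_lt_const
        (by simpa [Real.zero_rpow hp.ne', Real.zero_rpow (by linarith : 1 - p ≠ 0)] using hD)
    filter_upwards [h1, h2, self_mem_nhdsWithin] with η h1 h2 hη a ha
    have hη0 : 0 < η := hη
    have hmina : (a₀ + ε) ^ p - a₀ ^ p ≤ (a + ε) ^ p - a ^ p := hmin ha
    refine ⟨by linarith, ?_⟩
    have : (a ^ p + M * η ^ p) * (8 * η) ^ (1 - p) ≤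
        (A ^ p + M * η ^ p) * (8 * η) ^ (1 - p) := by
      gcongr
      · exact ha.1
      · exact ha.2
    linarith
  have hfin : ∀ᶠ η : ℝ in 𝓝[>] 0, ∀ j ∈ Finset.range (strictFloor β + 1), ∀ a ∈ Icc 0 A,
      1 ≤ j → (j : ℝ) < β → a ^ (j / β) + M * η ^ (j / β) ≤ (a + ε) ^ (j / β) ∧
      a ^ (j / β) + (a ^ (j / β) + M * η ^ (j / β)) * (8 * η) ^ (1 - j / β) ≤
        (a + ε) ^ (j / β) := by
    rw [Finset.eventually_all]
    intro j _
    by_cases hj : 1 ≤ j ∧ (j : ℝ) < β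
    · have hj0 : (0 : ℝ) < j := by exact_mod_cast hj.1
      filter_upwards [key (j / β) (by positivity) ((div_lt_one hβ).2 hj.2)] with η h a ha _ _
      exact h a ha
    · exact Eventually.of_forall fun η a _ h1 h2 => absurd ⟨h1, h2⟩ hj
  filter_upwards [hfin] with η h a ha j hj hjβ
  exact h j (Finset.mem_range.2 (Nat.lt_succ_of_le (le_strictFloor hjβ))) a ha hj hjβ

/-! ### The arcsine link -/

lemma arcsinLink_one_sub {x : ℝ} (hx : x ∈ Icc (0 : ℝ) 1) :
    arcsinLink (1 - x) = Real.pi - arcsinLink x := by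
  have h := Real.arccos_eq_arcsin (Real.sqrt_nonneg x)
  rw [Real.sq_sqrt hx.1] at h
  rw [arcsinLink, arcsinLink, ← h, Real.arccos]
  ring

lemma continuous_arcsinLink : Continuous arcsinLink :=
  continuous_const.mul (Real.continuous_arcsin.comp Real.continuous_sqrt)

/-- With `√u = sin α` and `√v = sin γ`, this is `2 |α - γ| / π ≤ |sin (α - γ)|`. -/
lemma sq_arcsinLink_sub_mul_le {u v : ℝ} (hu : u ∈ Icc (0 : ℝ) 1) (hv : v ∈ Icc (0 : ℝ) 1) :
    (arcsinLink u - arcsinLink v) ^ 2 * (u * (1 - v) + (1 - u) * v) ≤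
      Real.pi ^ 2 * (u - v) ^ 2 := by
  set α := Real.arcsin √u with hα
  set γ := Real.arcsin √v with hγ
  have hsin : ∀ w ∈ Icc (0 : ℝ) 1, Real.sin (Real.arcsin √w) = √w := fun w hw =>
    Real.sin_arcsin (by linarith [Real.sqrt_nonneg w]) (Real.sqrt_le_one.2 hw.2)
  have hcos : ∀ w ∈ Icc (0 : ℝ) 1, Real.cos (Real.arcsin √w) = √(1 - w) := fun w hw => by
    rw [Real.cos_arcsin, Real.sq_sqrt hw.1]
  have hα0 : 0 ≤ α := Real.arcsin_nonneg.2 (Real.sqrt_nonneg _)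
  have hγ0 : 0 ≤ γ := Real.arcsin_nonneg.2 (Real.sqrt_nonneg _)
  have hα1 : α ≤ Real.pi / 2 := Real.arcsin_le_pi_div_two _
  have hγ1 : γ ≤ Real.pi / 2 := Real.arcsin_le_pi_div_two _
  have hJ := Real.mul_abs_le_abs_sin (x := α - γ) (abs_le.2 ⟨by linarith, by linarith⟩)
  rw [Real.sin_sub, hα, hγ, hsin u hu, hsin v hv, hcos u hu, hcos v hv, ← hα, ← hγ] at hJ
  set p := √u * √(1 - v) with hp
  set q := √(1 - u) * √v with hq
  have hp2 : p ^ 2 = u * (1 - v) := by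
    rw [hp, mul_pow, Real.sq_sqrt hu.1, Real.sq_sqrt (by linarith [hv.2])]
  have hq2 : q ^ 2 = (1 - u) * v := by
    rw [hq, mul_pow, Real.sq_sqrt hv.1, Real.sq_sqrt (by linarith [hu.2])]
  have hp0 : 0 ≤ p := by positivity
  have hq0 : 0 ≤ q := by positivity
  have hπ := Real.pi_pos
  have hJ2 : (arcsinLink u - arcsinLink v) ^ 2 ≤ Real.pi ^ 2 * (p - q) ^ 2 := by
    have h1 : |2 * α - 2 * γ| ≤ |Real.pi * (p - q)| := by
      rw [← mul_sub, abs_mul, abs_mul, abs_of_pos hπ, abs_two]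
      calc 2 * |α - γ| = Real.pi * (2 / Real.pi * |α - γ|) := by field_simp
        _ ≤ Real.pi * |p - q| := by gcongr
    have := sq_le_sq.2 h1
    rwa [mul_pow] at this
  rw [← hp2, ← hq2]
  have huv : u - v = (p - q) * (p + q) := by linear_combination hq2 - hp2
  calc (arcsinLink u - arcsinLink v) ^ 2 * (p ^ 2 + q ^ 2)
      ≤ Real.pi ^ 2 * (p - q) ^ 2 * (p + q) ^ 2 := by
        gcongr
        nlinarith [mul_nonneg hp0 hq0]
    _ = Real.pi ^ 2 * (u - v) ^ 2 := by rw [huv]; ring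

/-! ### The bandwidth -/

/-- The bandwidth `n ^ (-1 / (β + 1)) ∨ (y / n) ^ (1 / (2 β + 1))` at a point where the function has
the value `y`; its `β`-th power has the order of the rate for `y ≤ 1 / 2`. -/
noncomputable def localScale (n : ℕ) (β y : ℝ) : ℝ :=
  max ((n : ℝ) ^ (-(1 / (β + 1)))) ((y / n) ^ (1 / (2 * β + 1)))

section LocalScale

variable {n : ℕ} {β y : ℝ}

lemma localScale_pos (hn : 0 < n) : 0 < localScale n β y := by
  have hn' : (0 : ℝ) < n := by exact_mod_cast hn
  exact lt_max_of_lt_left (by positivity)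

lemma localScale_le (hn : 0 < n) (hβ : 0 < β) (hy : y ∈ Icc (0 : ℝ) 1) :
    localScale n β y ≤ (n : ℝ) ^ (-(1 / (2 * β + 1))) := by
  have hn' : (1 : ℝ) ≤ n := by exact_mod_cast hn
  refine max_le (Real.rpow_le_rpow_of_exponent_le hn' ?_) ?_
  · rw [neg_le_neg_iff]
    exact one_div_le_one_div_of_le (by linarith) (by linarith)
  · rw [Real.rpow_neg (by positivity), ← Real.inv_rpow (by positivity)]
    refine Real.rpow_le_rpow (div_nonneg hy.1 (by positivity)) ?_ (by positivity)
    rw [inv_eq_one_div]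
    gcongr
    exact hy.2

lemma one_le_mul_localScale_rpow (hn : 0 < n) (hβ : 0 < β) :
    1 ≤ n * localScale n β y ^ (β + 1) := by
  have hn' : (0 : ℝ) < n := by exact_mod_cast hn
  have h : ((n : ℝ) ^ (-(1 / (β + 1)))) ^ (β + 1) ≤ localScale n β y ^ (β + 1) :=
    Real.rpow_le_rpow (by positivity) (le_max_left _ _) (by linarith)
  have h1 : -(1 / (β + 1)) * (β + 1) = -1 := by field_simp
  rw [← Real.rpow_mul hn'.le, h1, Real.rpow_neg_one] at h
  calc (1 : ℝ) = n * (n : ℝ)⁻¹ := by field_simp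
    _ ≤ _ := by gcongr

lemma le_mul_localScale_rpow (hn : 0 < n) (hβ : 0 < β) (hy : 0 ≤ y) :
    y ≤ n * localScale n β y ^ (2 * β + 1) := by
  have hn' : (0 : ℝ) < n := by exact_mod_cast hn
  have h : ((y / n) ^ (1 / (2 * β + 1))) ^ (2 * β + 1) ≤ localScale n β y ^ (2 * β + 1) :=
    Real.rpow_le_rpow (by positivity) (le_max_right _ _) (by linarith)
  rw [← Real.rpow_mul (by positivity), one_div_mul_cancel (by linarith), Real.rpow_one] at h
  calc y = n * (y / n) := by field_simp
    _ ≤ _ := by gcongr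

/-- The two regimes: either the value `y` is irrelevant for the bandwidth, or the bandwidth is below
the local scale `y ^ (1 / β)`. -/
lemma localScale_cases (hn : 0 < n) (hβ : 0 < β) (hy : 0 ≤ y) :
    n * localScale n β y ^ (β + 1) = 1 ∨
      (0 < y ∧ n * localScale n β y ^ (2 * β + 1) = y ∧ localScale n β y ≤ y ^ (1 / β)) := by
  have hn' : (0 : ℝ) < n := by exact_mod_cast hn
  rcases le_or_gt ((y / n) ^ (1 / (2 * β + 1))) ((n : ℝ) ^ (-(1 / (β + 1)))) with h | h
  · left
    rw [localScale, max_eq_left h, ← Real.rpow_mul hn'.le]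
    have h1 : -(1 / (β + 1)) * (β + 1) = -1 := by field_simp
    rw [h1, Real.rpow_neg_one]
    field_simp
  · right
    have hz : localScale n β y = (y / n) ^ (1 / (2 * β + 1)) := max_eq_right h.le
    have hy0 : 0 < y := by
      rcases hy.eq_or_lt with h0 | h0
      · rw [← h0, zero_div, Real.zero_rpow (by positivity)] at h
        exact absurd h (not_lt.2 (by positivity))
      · exact h0
    have h2 : n * localScale n β y ^ (2 * β + 1) = y := by
      rw [hz, ← Real.rpow_mul (by positivity), one_div_mul_cancel (by linarith), Real.rpow_one]
      field_simp
    refine ⟨hy0, h2, ?_⟩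
    have hzpos := localScale_pos (β := β) (y := y) hn
    set z := localScale n β y
    have h1 := one_le_mul_localScale_rpow (y := y) hn hβ
    have h3 : z ^ (2 * β + 1) = z ^ β * z ^ (β + 1) := by
      rw [← Real.rpow_add hzpos]; ring_nf
    have h4 : z ^ β ≤ y := by
      rw [← h2, h3]
      have := Real.rpow_nonneg hzpos.le β
      nlinarith
    calc z = (z ^ β) ^ (1 / β) := by
          rw [← Real.rpow_mul hzpos.le, mul_one_div_cancel hβ.ne', Real.rpow_one]
      _ ≤ y ^ (1 / β) := Real.rpow_le_rpow (by positivity) h4 (by positivity)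

lemma bernoulliRate_le {w : ℝ} (hn : 0 < n) (hβ : 0 < β) (hy : 0 ≤ y) (hw : w ∈ Icc (0 : ℝ) 1)
    (hwy : w ≤ y + localScale n β y ^ β) :
    bernoulliRate n β w ≤ 2 * localScale n β y ^ β := by
  have hn' : (0 : ℝ) < n := by exact_mod_cast hn
  have hzpos := localScale_pos (β := β) (y := y) hn
  have h1 := one_le_mul_localScale_rpow (y := y) hn hβ
  have h2 := le_mul_localScale_rpow hn hβ hy
  set z := localScale n β y
  have hzβ : 0 < z ^ β := by positivity
  have h1' : (n : ℝ)⁻¹ ≤ z ^ (β + 1) := by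
    rw [inv_le_iff_one_le_mul₀' hn']; exact h1
  refine max_le ?_ ?_
  · have h3 := Real.rpow_le_rpow (by positivity) h1'
      (by positivity : (0 : ℝ) ≤ β / (β + 1))
    have h4 : (β + 1) * (β / (β + 1)) = β := by field_simp
    rw [← Real.rpow_mul hzpos.le, h4, Real.inv_rpow hn'.le, ← Real.rpow_neg hn'.le] at h3
    linarith
  · have h3 : z ^ (2 * β + 1) = z ^ β * z ^ (β + 1) := by
      rw [← Real.rpow_add hzpos]; ring_nf
    have h5 : w * (1 - w) / n ≤ 2 * z ^ (2 * β + 1) := by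
      have hw1 : w * (1 - w) ≤ w := by nlinarith [hw.1]
      rw [div_le_iff₀ hn']
      have : z ^ β ≤ n * z ^ (2 * β + 1) := by rw [h3]; nlinarith
      linarith
    have h0 : 0 ≤ w * (1 - w) / n :=
      div_nonneg (mul_nonneg hw.1 (by linarith [hw.2])) hn'.le
    calc (w * (1 - w) / n) ^ (β / (2 * β + 1))
        ≤ (2 * z ^ (2 * β + 1)) ^ (β / (2 * β + 1)) := Real.rpow_le_rpow h0 h5 (by positivity)
      _ = 2 ^ (β / (2 * β + 1)) * z ^ β := by
          rw [Real.mul_rpow (by norm_num) (by positivity), ← Real.rpow_mul hzpos.le]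
          congr 2
          field_simp
      _ ≤ 2 ^ (1 : ℝ) * z ^ β := by
          gcongr
          · norm_num
          · rw [div_le_one (by positivity)]; linarith
      _ = 2 * z ^ β := by rw [Real.rpow_one]

end LocalScale

/-! ### The perturbation -/

open Topology in
/-- A function `φ` with `φ(x₀) ≤ 1 / 2` can be raised at `x₀` by a multiple of the rate, at a cost
`ε` in each norm and at a bounded cost in the statistical distance. -/
lemma exists_upward_perturbation {β A ε : ℝ} (hβ : 0 < β) (hA : 0 ≤ A) (hε : 0 < ε) :
    ∃ C : ℝ, 0 < C ∧ ∃ N : ℕ, 0 < N ∧ ∀ n ≥ N, ∀ φ : ℝ → ℝ, MapsTo φ (Icc 0 1) (Icc 0 1) →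
      ContDiffOn ℝ (strictFloor β : ℕ) φ (Icc 0 1) → flatSeminorm β φ ≤ ENNReal.ofReal A →
      flatSeminorm β (fun x => 1 - φ x) ≤ ENNReal.ofReal A →
      (β ≤ 1 → ∀ x ∈ Icc (0 : ℝ) 1, ∀ y ∈ Icc (0 : ℝ) 1, |φ x - φ y| ≤ A * |x - y| ^ β) →
      ∀ x₀ ∈ Icc (0 : ℝ) 1, φ x₀ ≤ 1 / 2 → ∃ ψ : ℝ → ℝ,
        (∀ x, 0 ≤ ψ x) ∧ (∀ x ∈ Icc (0 : ℝ) 1, φ x + ψ x ≤ 1) ∧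
        holderNorm β ψ ≤ ENNReal.ofReal ε ∧
        flatSeminorm β (fun x => φ x + ψ x) ≤ flatSeminorm β φ + ENNReal.ofReal ε ∧
        flatSeminorm β (fun x => 1 - (φ x + ψ x)) ≤
          flatSeminorm β (fun x => 1 - φ x) + ENNReal.ofReal ε ∧
        n * ∫ x in Ioc 0 1, (arcsinLink (φ x + ψ x) - arcsinLink (φ x)) ^ 2 ≤ 1 / 2 ∧
        C * (bernoulliRate n β (φ x₀) + bernoulliRate n β (φ x₀ + ψ x₀)) ≤ ψ x₀ := by
  obtain ⟨M, hM, hbump⟩ := exists_flat_bump hβ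
  obtain ⟨κ, hκ, hκ1, hlocal⟩ := exists_half_le_of_flat hβ hA
  have hπ := Real.pi_pos
  obtain ⟨η, hbudget, hη, hηε, hη8, hηπ⟩ : ∃ η : ℝ, (∀ a ∈ Icc 0 A, ∀ j : ℕ, 1 ≤ j → (j : ℝ) < β →
      a ^ (j / β) + M * η ^ (j / β) ≤ (a + ε) ^ (j / β) ∧
      a ^ (j / β) + (a ^ (j / β) + M * η ^ (j / β)) * (8 * η) ^ (1 - j / β) ≤
        (a + ε) ^ (j / β)) ∧ 0 < η ∧ M * η ≤ ε ∧ η ≤ 1 / 8 ∧ η ≤ 1 / (16 * Real.pi ^ 2) := by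
    have hlt : ∀ c : ℝ, 0 < c → ∀ᶠ η : ℝ in 𝓝[>] 0, η ≤ c := fun c hc =>
      (eventually_lt_nhds hc).filter_mono nhdsWithin_le_nhds |>.mono fun _ h => h.le
    obtain ⟨η, h1, h2, h3, h4, h5⟩ := ((eventually_flatness_budget (M := M) hβ hε hA).and
      (eventually_mem_nhdsWithin.and ((hlt (ε / M) (by positivity)).and
        ((hlt (1 / 8) (by norm_num)).and (hlt (1 / (16 * Real.pi ^ 2)) (by positivity)))))).exists
    refine ⟨η, h1, h2, ?_, h4, h5⟩
    rwa [le_div_iff₀ hM, mul_comm] at h3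
  have hηπ' : 16 * Real.pi ^ 2 * η ≤ 1 := by
    rwa [le_div_iff₀ (by positivity), mul_comm] at hηπ
  -- from some `N` on, the bandwidth is below the local scale of `1 - φ` at `x₀`
  obtain ⟨N, hN⟩ : ∃ N : ℕ, ∀ n ≥ N, (n : ℝ) ^ (-(1 / (2 * β + 1))) ≤ (1 / 2 : ℝ) ^ (1 / β) := by
    have h1 : Tendsto (fun n : ℕ => (n : ℝ) ^ (-(1 / (2 * β + 1)))) atTop (𝓝 0) :=
      (tendsto_rpow_neg_atTop (by positivity)).comp tendsto_natCast_atTop_atTop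
    exact eventually_atTop.1 (h1.eventually_le_const (by positivity))
  refine ⟨η * κ ^ β / 4, by positivity, N + 1, Nat.succ_pos _, fun n hn φ hφ hφc hφf hφf' hφH x₀ hx₀
    hφx₀ => ?_⟩
  have hnpos : 0 < n := by omega
  have hn' : (0 : ℝ) < n := by exact_mod_cast hnpos
  set y := φ x₀ with hy
  have hyI : y ∈ Icc (0 : ℝ) 1 := hφ hx₀
  set z := localScale n β y with hz
  have hz0 : 0 < z := localScale_pos hnpos
  have hzle : z ≤ (1 / 2 : ℝ) ^ (1 / β) :=
    (localScale_le hnpos hβ hyI).trans (hN n (by omega))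
  have hz1 : z ≤ 1 := hzle.trans (Real.rpow_le_one (by norm_num) (by norm_num) (by positivity))
  set b := κ * z with hb
  have hb0 : 0 < b := by positivity
  have hbz : b ≤ z := mul_le_of_le_one_left hz0.le hκ1
  have hb1 : b ≤ 1 := hbz.trans hz1
  obtain ⟨ψ, hψc, hψ0, hψle, hψx₀, hψs, hψf, hψn⟩ := hbump x₀ η b hη hb0 hb1
  have hbβ0 : 0 < b ^ β := by positivity
  have hbβ : b ^ β ≤ 1 := Real.rpow_le_one hb0.le hb1 hβ.le
  have hψη : ∀ x, ψ x ≤ η := fun x => (hψle x).trans (mul_le_of_le_one_right hη.le hbβ)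
  have hψk : ContDiffOn ℝ (strictFloor β : ℕ) ψ (Icc 0 1) :=
    (hψc.of_le (by exact_mod_cast le_top)).contDiffOn
  have hsupp : ∀ x, ψ x ≠ 0 → |x - x₀| ≤ b := fun x hx => by
    by_contra h
    exact hx (hψs x (not_le.1 h).le)
  -- on the support of the bump, `1 - φ ≥ 1 / 4`
  have hquarter : ∀ x ∈ Icc (0 : ℝ) 1, ψ x ≠ 0 → 1 / 4 ≤ 1 - φ x := by
    intro x hx hψx
    have h := hlocal (fun x => 1 - φ x) (fun x hx => by linarith [(hφ hx).2])
      (contDiffOn_const.sub hφc) hφf'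
      (fun h1 x hx y hy => by
        have := hφH h1 x hx y hy
        rwa [sub_sub_sub_cancel_left, abs_sub_comm]) x₀ hx₀ x hx ((hsupp x hψx).trans ?_)
    · linarith
    · rw [hb]
      refine mul_le_mul_of_nonneg_left (hzle.trans ?_) hκ.le
      exact Real.rpow_le_rpow (by norm_num) (by linarith) (by positivity)
  have hsum1 : ∀ x ∈ Icc (0 : ℝ) 1, φ x + ψ x ≤ 1 := fun x hx => by
    by_cases h : ψ x = 0
    · rw [h]; linarith [(hφ hx).2]
    · linarith [hquarter x hx h, hψη x]
  have hB : ∀ j : ℕ, 0 ≤ M * η ^ ((j : ℝ) / β) := fun j => by positivity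
  refine ⟨ψ, hψ0, hsum1, hψn.trans (ENNReal.ofReal_le_ofReal hηε), ?_, ?_, ?_, ?_⟩
  · set a := (flatSeminorm β φ).toReal with ha
    have ha0 : 0 ≤ a := ENNReal.toReal_nonneg
    have hane : flatSeminorm β φ ≠ ∞ := ne_top_of_le_ne_top ENNReal.ofReal_ne_top hφf
    have haA : a ≤ A := ENNReal.toReal_le_of_le_ofReal hA hφf
    rw [← ENNReal.ofReal_toReal hane, ← ha, ← ENNReal.ofReal_add ha0 hε.le]
    exact flatSeminorm_add_le_of_flat hβ ha0 (by positivity) (fun x hx => (hφ hx).1) hψ0 hB hφc hψk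
      (ENNReal.ofReal_toReal hane).ge hψf fun j hj hjβ => (hbudget a ⟨ha0, haA⟩ j hj hjβ).1
  · set a := (flatSeminorm β fun x => 1 - φ x).toReal with ha
    have ha0 : 0 ≤ a := ENNReal.toReal_nonneg
    have hane : flatSeminorm β (fun x => 1 - φ x) ≠ ∞ :=
      ne_top_of_le_ne_top ENNReal.ofReal_ne_top hφf'
    have haA : a ≤ A := ENNReal.toReal_le_of_le_ofReal hA hφf'
    rw [← ENNReal.ofReal_toReal hane, ← ha, ← ENNReal.ofReal_add ha0 hε.le]
    simp_rw [← sub_sub]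
    refine flatSeminorm_sub_le_of_flat (d := 8 * η) (φ := fun x => 1 - φ x) hβ ha0 (by positivity)
      (by positivity) hψ0 hB (fun x hx => by linarith [hsum1 x hx]) (fun x hx => ?_)
      (contDiffOn_const.sub hφc) hψk (ENNReal.ofReal_toReal hane).ge hψf
      fun j hj hjβ => (hbudget a ⟨ha0, haA⟩ j hj hjβ).2
    by_cases h : ψ x = 0
    · rw [h]
      exact mul_nonneg (by positivity) (by linarith [(hφ hx).2])
    · have h1 := hquarter x hx h
      have h2 := hψη x
      nlinarith
  · -- pointwise, the squared drift is at most `4 π² ψ² / (φ + ψ)`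
    have hpt : ∀ x ∈ Icc (0 : ℝ) 1, (arcsinLink (φ x + ψ x) - arcsinLink (φ x)) ^ 2 *
        (φ x + ψ x) ≤ 4 * Real.pi ^ 2 * ψ x ^ 2 := by
      intro x hx
      by_cases h : ψ x = 0
      · simp [h]
      have hφx := hφ hx
      have h1 := sq_arcsinLink_sub_mul_le (u := φ x + ψ x) (v := φ x)
        ⟨add_nonneg hφx.1 (hψ0 x), hsum1 x hx⟩ hφx
      rw [add_sub_cancel_left] at h1
      have h2 := hquarter x hx h
      have h3 : (φ x + ψ x) / 4 ≤ (φ x + ψ x) * (1 - φ x) + (1 - (φ x + ψ x)) * φ x := by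
        have := mul_nonneg (sub_nonneg.2 (hsum1 x hx)) hφx.1
        nlinarith [add_nonneg hφx.1 (hψ0 x)]
      have h4 := mul_le_mul_of_nonneg_left h3
        (sq_nonneg (arcsinLink (φ x + ψ x) - arcsinLink (φ x)))
      linarith
    -- a uniform bound on the support turns into a bound for the integral
    have hint : ∀ B : ℝ, 0 ≤ B → (∀ x ∈ Icc (0 : ℝ) 1, ψ x ≠ 0 →
        (arcsinLink (φ x + ψ x) - arcsinLink (φ x)) ^ 2 ≤ B) →
        ∫ x in Ioc 0 1, (arcsinLink (φ x + ψ x) - arcsinLink (φ x)) ^ 2 ≤ B * (2 * b) := by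
      intro B hB0 hBle
      calc ∫ x in Ioc 0 1, (arcsinLink (φ x + ψ x) - arcsinLink (φ x)) ^ 2
          ≤ ∫ x in Ioc 0 1, (Icc (x₀ - b) (x₀ + b)).indicator (fun _ => B) x := by
            refine integral_mono_of_nonneg (Eventually.of_forall fun x => sq_nonneg _)
              ((integrable_const B).indicator measurableSet_Icc) ?_
            filter_upwards [ae_restrict_mem measurableSet_Ioc] with x hx
            by_cases h : ψ x = 0
            · simp only [h, add_zero, sub_self]
              rw [zero_pow two_ne_zero]
              exact indicator_nonneg (fun _ _ => hB0) x
            · have h1 := abs_le.1 (hsupp x h)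
              rw [indicator_of_mem (show x ∈ Icc (x₀ - b) (x₀ + b) from ⟨by linarith, by linarith⟩)]
              exact hBle x (Ioc_subset_Icc_self hx) h
        _ ≤ ∫ x, (Icc (x₀ - b) (x₀ + b)).indicator (fun _ => B) x := by
            refine setIntegral_le_integral ?_
              (Eventually.of_forall fun x => indicator_nonneg (fun _ _ => hB0) x)
            rw [integrable_indicator_iff measurableSet_Icc]
            exact integrableOn_const (by simp)
        _ = B * (2 * b) := by
            rw [integral_indicator_const _ measurableSet_Icc, Real.volume_real_Icc_of_le (by linarith),
              smul_eq_mul]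
            ring
    have hbpow : ∀ s : ℝ, 0 ≤ s → b ^ s ≤ z ^ s := fun s hs => Real.rpow_le_rpow hb0.le hbz hs
    rcases localScale_cases hnpos hβ hyI.1 with hcase | ⟨hy0, hcase, hzy⟩
    · have h1 := hint (4 * Real.pi ^ 2 * (η * b ^ β)) (by positivity) fun x hx hψx => by
        have h2 := hpt x hx
        have h3 : 0 < ψ x := lt_of_le_of_ne (hψ0 x) (Ne.symm hψx)
        have h4 := (hφ hx).1
        set q := (arcsinLink (φ x + ψ x) - arcsinLink (φ x)) ^ 2
        have hq : 0 ≤ q := sq_nonneg _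
        have h5 : q ≤ 4 * Real.pi ^ 2 * ψ x := by
          refine le_of_mul_le_mul_right ?_ h3
          calc q * ψ x ≤ q * (φ x + ψ x) := by gcongr; linarith
            _ ≤ _ := h2
            _ = _ := by ring
        exact h5.trans (by gcongr; exact hψle x)
      have h2 : b ^ β * b ≤ z ^ (β + 1) := by
        calc b ^ β * b = b ^ (β + 1) := by rw [Real.rpow_add_one hb0.ne']
          _ ≤ _ := hbpow _ (by linarith)
      calc n * ∫ x in Ioc 0 1, (arcsinLink (φ x + ψ x) - arcsinLink (φ x)) ^ 2
          ≤ n * (4 * Real.pi ^ 2 * (η * b ^ β) * (2 * b)) := by gcongr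
        _ = 8 * Real.pi ^ 2 * η * (n * (b ^ β * b)) := by ring
        _ ≤ 8 * Real.pi ^ 2 * η * (n * z ^ (β + 1)) := by gcongr
        _ ≤ 1 / 2 := by rw [hcase]; linarith
    · have h1 := hint (4 * Real.pi ^ 2 * (η * b ^ β) ^ 2 / (y / 2)) (by positivity)
        fun x hx hψx => by
        have h2 := hpt x hx
        have h3 : y / 2 ≤ φ x := by
          refine hlocal φ (fun x hx => (hφ hx).1) hφc hφf hφH x₀ hx₀ x hx ((hsupp x hψx).trans ?_)
          rw [hb]
          gcongr
        set q := (arcsinLink (φ x + ψ x) - arcsinLink (φ x)) ^ 2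
        have hq : 0 ≤ q := sq_nonneg _
        rw [le_div_iff₀ (by positivity)]
        calc q * (y / 2) ≤ q * (φ x + ψ x) := by gcongr; linarith [hψ0 x]
          _ ≤ _ := h2
          _ ≤ _ := by
            have := hψ0 x
            gcongr
            exact hψle x
      have h2 : (b ^ β) ^ 2 * b ≤ z ^ (2 * β + 1) := by
        calc (b ^ β) ^ 2 * b = b ^ (2 * β + 1) := by
              rw [Real.rpow_add_one hb0.ne', mul_comm 2 β, Real.rpow_mul hb0.le, Real.rpow_two]
          _ ≤ _ := hbpow _ (by linarith)
      calc n * ∫ x in Ioc 0 1, (arcsinLink (φ x + ψ x) - arcsinLink (φ x)) ^ 2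
          ≤ n * (4 * Real.pi ^ 2 * (η * b ^ β) ^ 2 / (y / 2) * (2 * b)) := by gcongr
        _ = 16 * Real.pi ^ 2 * η ^ 2 * (n * ((b ^ β) ^ 2 * b)) / y := by field_simp; ring
        _ ≤ 16 * Real.pi ^ 2 * η ^ 2 * (n * z ^ (2 * β + 1)) / y := by gcongr
        _ = 16 * Real.pi ^ 2 * η * η := by rw [hcase]; field_simp
        _ ≤ 1 / 2 := by nlinarith
  · have hzβ : 0 < z ^ β := by positivity
    have hbz' : b ^ β ≤ z ^ β := Real.rpow_le_rpow hb0.le hbz hβ.le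
    have hψz : ψ x₀ ≤ z ^ β := by
      rw [hψx₀]
      nlinarith
    have h1 := bernoulliRate_le hnpos hβ hyI.1 hyI (by linarith)
    have h2 := bernoulliRate_le (w := y + ψ x₀) hnpos hβ hyI.1
      ⟨add_nonneg hyI.1 (hψ0 _), hsum1 x₀ hx₀⟩ (by linarith)
    calc η * κ ^ β / 4 * (bernoulliRate n β y + bernoulliRate n β (y + ψ x₀))
        ≤ η * κ ^ β / 4 * (2 * z ^ β + 2 * z ^ β) := by gcongr
      _ = η * (κ ^ β * z ^ β) := by ring
      _ = ψ x₀ := by rw [hψx₀, hb, Real.mul_rpow hκ.le hz0.le]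

lemma bernoulliRate_one_sub (n : ℕ) (β w : ℝ) :
    bernoulliRate n β (1 - w) = bernoulliRate n β w := by
  simp only [bernoulliRate, sub_sub_cancel, mul_comm]

lemma bernoulliRate_pos {n : ℕ} (hn : 0 < n) (β w : ℝ) : 0 < bernoulliRate n β w := by
  have hn' : (0 : ℝ) < n := by exact_mod_cast hn
  exact lt_max_of_lt_left (by positivity)

/-- Around every `g` in a ball of radius `A < R` there is an alternative `f` in the ball of radius
`R` which is statistically close to `g` and separated from it at `x₀` by a multiple of the rate. -/
lemma exists_alternative {β A R : ℝ} (hβ : 0 < β) (hA : 0 ≤ A) (hAR : A < R) :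
    ∃ C : ℝ, 0 < C ∧ ∃ N : ℕ, 0 < N ∧ ∀ n ≥ N, ∀ g ∈ bernoulliBall β A, ∀ x₀ ∈ Icc (0 : ℝ) 1,
      ∃ f ∈ bernoulliBall β R,
        n * ∫ x in Ioc 0 1, (arcsinLink (f x) - arcsinLink (g x)) ^ 2 ≤ 1 / 2 ∧
        C * (bernoulliRate n β (g x₀) + bernoulliRate n β (f x₀)) ≤ |f x₀ - g x₀| := by
  set ε := (R - A) / 3 with hε
  have hε0 : 0 < ε := by rw [hε]; linarith
  obtain ⟨C, hC, N, hN, hmain⟩ := exists_upward_perturbation hβ hA hε0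
  refine ⟨C, hC, N, hN, fun n hn g ⟨hg, hgn⟩ x₀ hx₀ => ?_⟩
  have hH : holderNorm β g ≤ ENNReal.ofReal A := (le_self_add.trans le_self_add).trans hgn
  have hF : flatSeminorm β g ≤ ENNReal.ofReal A := (le_add_self.trans le_self_add).trans hgn
  have hF' : flatSeminorm β (fun x => 1 - g x) ≤ ENNReal.ofReal A := le_add_self.trans hgn
  have hc : ContDiffOn ℝ (strictFloor β : ℕ) g (Icc 0 1) :=
    contDiffOn_of_holderNorm_ne_top (ne_top_of_le_ne_top ENNReal.ofReal_ne_top hH)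
  have hHölder : β ≤ 1 → ∀ x ∈ Icc (0 : ℝ) 1, ∀ y ∈ Icc (0 : ℝ) 1, |g x - g y| ≤ A * |x - y| ^ β :=
    fun h1 x hx y hy => abs_sub_le_of_holderNorm_le hβ h1 hA hH hx hy
  have htotal : ∀ f : ℝ → ℝ, holderNorm β f ≤ holderNorm β g + ENNReal.ofReal ε →
      flatSeminorm β f ≤ flatSeminorm β g + ENNReal.ofReal ε →
      flatSeminorm β (fun x => 1 - f x) ≤ flatSeminorm β (fun x => 1 - g x) + ENNReal.ofReal ε →
      bernoulliNorm β f ≤ ENNReal.ofReal R := by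
    intro f h1 h2 h3
    calc bernoulliNorm β f ≤ (holderNorm β g + ENNReal.ofReal ε) +
          (flatSeminorm β g + ENNReal.ofReal ε) +
          (flatSeminorm β (fun x => 1 - g x) + ENNReal.ofReal ε) := add_le_add (add_le_add h1 h2) h3
      _ = bernoulliNorm β g + (ENNReal.ofReal ε + ENNReal.ofReal ε + ENNReal.ofReal ε) := by
          rw [bernoulliNorm]; ring
      _ ≤ ENNReal.ofReal A + (ENNReal.ofReal ε + ENNReal.ofReal ε + ENNReal.ofReal ε) := by gcongr
      _ = ENNReal.ofReal R := by
          rw [← ENNReal.ofReal_add hε0.le hε0.le, ← ENNReal.ofReal_add (by positivity) hε0.le,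
            ← ENNReal.ofReal_add hA (by positivity)]
          congr 1
          rw [hε]; ring
  rcases le_or_gt (g x₀) (1 / 2) with hhalf | hhalf
  · obtain ⟨ψ, hψ0, hsum, hψn, h1, h2, hI, hsep⟩ :=
      hmain n hn g hg hc hF hF' hHölder x₀ hx₀ hhalf
    refine ⟨fun x => g x + ψ x, ⟨fun x hx => ⟨add_nonneg (hg hx).1 (hψ0 x), hsum x hx⟩, ?_⟩, hI, ?_⟩
    · exact htotal _ ((holderNorm_add_le β g ψ).trans (by gcongr)) h1 h2
    · rw [add_sub_cancel_left, abs_of_nonneg (hψ0 x₀)]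
      exact hsep
  · -- for large values, raise `1 - g` instead
    have hself : (fun x => 1 - (1 - g x)) = g := funext fun x => by ring
    obtain ⟨ψ, hψ0, hsum, hψn, h1, h2, hI, hsep⟩ := hmain n hn (fun x => 1 - g x)
      (fun x hx => ⟨by linarith [(hg hx).2], by linarith [(hg hx).1]⟩) (contDiffOn_const.sub hc) hF'
      (by rwa [hself])
      (fun hβ1 x hx y hy => by
        rw [sub_sub_sub_cancel_left, abs_sub_comm]; exact hHölder hβ1 x hx y hy)
      x₀ hx₀ (by linarith)
    have hf : (fun x => 1 - (1 - g x + ψ x)) = fun x => g x - ψ x := funext fun x => by ring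
    have hf' : (fun x => 1 - (g x - ψ x)) = fun x => 1 - g x + ψ x := funext fun x => by ring
    rw [hself, hf] at h2
    have hmap : MapsTo (fun x => g x - ψ x) (Icc 0 1) (Icc 0 1) := fun x hx =>
      ⟨by linarith [hsum x hx], by linarith [(hg hx).2, hψ0 x]⟩
    refine ⟨fun x => g x - ψ x, ⟨hmap, ?_⟩, ?_, ?_⟩
    · refine htotal _ ?_ h2 (by rw [hf']; exact h1)
      simp_rw [sub_eq_add_neg]
      refine (holderNorm_add_le β g fun x => -ψ x).trans ?_
      rw [holderNorm_neg]
      gcongr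
    · refine le_trans (le_of_eq ?_) hI
      congr 1
      refine setIntegral_congr_fun measurableSet_Ioc fun x hx => ?_
      have hx' := Ioc_subset_Icc_self hx
      have h3 : 1 - g x + ψ x = 1 - (g x - ψ x) := by ring
      simp only
      rw [h3, arcsinLink_one_sub (hmap hx'), arcsinLink_one_sub (hg hx')]
      ring
    · have h3 : 1 - g x₀ + ψ x₀ = 1 - (g x₀ - ψ x₀) := by ring
      rw [h3, bernoulliRate_one_sub, bernoulliRate_one_sub] at hsep
      have h4 : g x₀ - ψ x₀ - g x₀ = -ψ x₀ := by ring
      rw [h4, abs_neg, abs_of_nonneg (hψ0 x₀)]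
      exact hsep

/-! ### The two-point bound -/

lemma continuousOn_arcsinLink_comp {β R : ℝ} {f : ℝ → ℝ} (hf : f ∈ bernoulliBall β R) :
    ContinuousOn (fun x => arcsinLink (f x)) (Icc 0 1) := by
  have h : holderNorm β f ≤ ENNReal.ofReal R := (le_self_add.trans le_self_add).trans hf.2
  exact continuous_arcsinLink.comp_continuousOn
    (contDiffOn_of_holderNorm_ne_top (ne_top_of_le_ne_top ENNReal.ofReal_ne_top h)).continuousOn

lemma ContinuousOn.memLp_restrict_Ioc {c : ℝ → ℝ} (hc : ContinuousOn c (Icc 0 1)) :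
    MemLp c 2 (volume.restrict (Ioc 0 1)) := by
  obtain ⟨B, hB⟩ := isCompact_Icc.exists_bound_of_continuousOn hc
  refine MemLp.of_bound ((hc.mono Ioc_subset_Icc_self).aestronglyMeasurable measurableSet_Ioc) B ?_
  filter_upwards [ae_restrict_mem measurableSet_Ioc] with x hx
  exact hB x (Ioc_subset_Icc_self hx)

theorem theorem5 (β R₀ R : ℝ) (hβ : 0 < β) (hR₀ : 0 ≤ R₀) (hR : R₀ < R) :
    ∃ C : ℝ, 0 < C ∧
      ∀ x₀ ∈ Icc (0 : ℝ) 1, ∀ fstar : ℕ → ℝ → ℝ,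
        (∀ n, MapsTo (fstar n) (Icc 0 1) (Icc 0 1)) →
        limsup (fun n => bernoulliNorm β (fstar n)) atTop ≤ ENNReal.ofReal R₀ →
        ∀ (Ω : Type*) [MeasurableSpace Ω] (P : Measure Ω) (W : ℝ≥0 → Ω → ℝ),
          IsBrownianReal W P →
          0 < liminf (fun n : ℕ =>
            ⨅ fhat : Estimator, ⨆ f ∈ localSpace P W β R n (fstar n),
              pathLaw P W n f
                {Y | C ≤ |fhat.1 Y - f x₀| / bernoulliRate n β (f x₀)}) atTop := by
  set A := (R₀ + R) / 2 with hA
  have hA0 : 0 < A := by rw [hA]; linarith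
  obtain ⟨C, hC, N, hN, halt⟩ :=
    exists_alternative hβ hA0.le (by rw [hA]; linarith : A < R)
  refine ⟨C, hC, fun x₀ hx₀ fstar hmap hlim Ω _ P W hW => ?_⟩
  have hev : ∀ᶠ n in atTop, bernoulliNorm β (fstar n) < ENNReal.ofReal A := by
    refine eventually_lt_of_limsup_lt (hlim.trans_lt ?_)
    exact (ENNReal.ofReal_lt_ofReal_iff hA0).2 (by rw [hA]; linarith)
  refine lt_of_lt_of_le (by norm_num : (0 : ℝ≥0∞) < 1 / 8) (le_liminf_of_le (by isBoundedDefault) ?_)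
  filter_upwards [hev, eventually_ge_atTop N] with n hgn hnN
  have hn : 0 < n := hN.trans_le hnN
  set g := fstar n
  have hg : g ∈ bernoulliBall β A := ⟨hmap n, hgn.le⟩
  obtain ⟨f, hf, hI, hsep⟩ := halt n hnN g hg x₀ hx₀
  have hgR : g ∈ bernoulliBall β R :=
    ⟨hg.1, hg.2.trans (ENNReal.ofReal_le_ofReal (by rw [hA]; linarith))⟩
  have hcf := continuousOn_arcsinLink_comp hf
  have hcg := continuousOn_arcsinLink_comp hg
  have hif : IntegrableOn (fun x => arcsinLink (f x)) (Ioc 0 1) :=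
    hcf.integrableOn_Icc.mono_set Ioc_subset_Icc_self
  have hig : IntegrableOn (fun x => arcsinLink (g x)) (Ioc 0 1) :=
    hcg.integrableOn_Icc.mono_set Ioc_subset_Icc_self
  obtain ⟨hpf, hkl, hmeas⟩ :=
    pathLaw_divergence_bounds hW hn hif hig (hcf.sub hcg).memLp_restrict_Ioc hI
  obtain ⟨hpg, -, -⟩ := pathLaw_divergence_bounds (K := 0) hW hn hig hig
    (hcg.sub hcg).memLp_restrict_Ioc (by simp)
  have hexp : Real.exp (1 / 2) ≤ 2 := by
    have h1 : Real.exp (1 / 2) ^ 2 = Real.exp 1 := by rw [← Real.exp_nat_mul]; norm_num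
    have h2 := Real.exp_one_lt_d9
    nlinarith [Real.exp_pos (1 / 2)]
  have hexp' : ENNReal.ofReal (Real.exp (1 / 2)) ≤ 2 := by
    rw [← ENNReal.ofReal_ofNat 2]
    exact ENNReal.ofReal_le_ofReal hexp
  have hgmem : g ∈ localSpace P W β R n g :=
    ⟨hgR, by rw [InformationTheory.klDiv_self]; exact zero_le⟩
  have hfmem : f ∈ localSpace P W β R n g := by
    refine ⟨hf, ?_⟩
    have h := hkl.trans hexp'
    rw [← one_add_one_eq_two] at h
    exact (ENNReal.add_le_add_iff_right ENNReal.one_ne_top).1 h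
  refine le_iInf fun fhat => ?_
  by_contra! hlt
  set S : (ℝ → ℝ) → Set (unitInterval → ℝ) := fun f =>
    {Y | C ≤ |fhat.1 Y - f x₀| / bernoulliRate n β (f x₀)} with hS
  have hSm : ∀ f, MeasurableSet (S f) := fun f =>
    measurableSet_le measurable_const
      (((continuous_abs.measurable.comp (fhat.2.sub_const _))).div_const _)
  have hSg : pathLaw P W n g (S g) < 1 / 8 :=
    lt_of_le_of_lt (le_iSup₂_of_le g hgmem le_rfl) hlt
  have hSf : pathLaw P W n f (S f) < 1 / 8 :=
    lt_of_le_of_lt (le_iSup₂_of_le f hfmem le_rfl) hlt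
  -- the estimator cannot be close to both values
  have hsub : (S f)ᶜ ⊆ S g := by
    intro Y hY
    by_contra hY'
    have h1 : |fhat.1 Y - f x₀| / bernoulliRate n β (f x₀) < C := not_le.1 hY
    have h2 : |fhat.1 Y - g x₀| / bernoulliRate n β (g x₀) < C := not_le.1 hY'
    rw [div_lt_iff₀ (bernoulliRate_pos hn β _)] at h1 h2
    have h3 : |f x₀ - g x₀| ≤ |fhat.1 Y - f x₀| + |fhat.1 Y - g x₀| := by
      rw [abs_sub_comm (fhat.1 Y) (f x₀)]
      exact abs_sub_le _ _ _
    linarith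
  have h1 : 1 ≤ pathLaw P W n f (S f) + pathLaw P W n f (S g) := by
    rw [← measure_univ (μ := pathLaw P W n f), ← measure_add_measure_compl (hSm f)]
    gcongr
  have h2 := (hmeas (S g) (hSm g)).trans (mul_le_mul_left hexp' _)
  have e1 := ENNReal.ofReal_toReal (measure_ne_top (pathLaw P W n f) (S f))
  have e2 := ENNReal.ofReal_toReal (measure_ne_top (pathLaw P W n f) (S g))
  have e3 := ENNReal.ofReal_toReal (measure_ne_top (pathLaw P W n g) (S g))
  set p := (pathLaw P W n f (S f)).toReal
  set q := (pathLaw P W n f (S g)).toReal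
  set r := (pathLaw P W n g (S g)).toReal
  have hp : 0 ≤ p := ENNReal.toReal_nonneg
  have hq : 0 ≤ q := ENNReal.toReal_nonneg
  have hr : 0 ≤ r := ENNReal.toReal_nonneg
  have h8 : (1 / 8 : ℝ≥0∞) = ENNReal.ofReal (1 / 8) := by
    rw [ENNReal.ofReal_div_of_pos (by norm_num)]; simp
  rw [← e3, h8, ENNReal.ofReal_lt_ofReal_iff (by norm_num)] at hSg
  rw [← e1, h8, ENNReal.ofReal_lt_ofReal_iff (by norm_num)] at hSf
  rw [← e1, ← e2, ← ENNReal.ofReal_add hp hq, ← ENNReal.ofReal_one,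
    ENNReal.ofReal_le_ofReal_iff (by positivity)] at h1
  rw [← e2, ← e3, ← ENNReal.ofReal_pow hq, ← ENNReal.ofReal_ofNat 2,
    ← ENNReal.ofReal_mul (by norm_num), ENNReal.ofReal_le_ofReal_iff (by positivity)] at h2
  nlinarith
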